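/- Let $d,\nu\ge 1$ and let $\mathbb T^\nu=\mathbb R^\nu/\mathbb Z^\nu$ carry the normalized Haar measure $\mathbb P$ and the max-distance; all norms on $\mathbb Z^d$ and $\mathbb Z^{2d}=\mathbb Z^d\times\mathbb Z^d$ are max-norms. Let $(T^x)_{x\in\mathbb Z^d}$ be a measure-preserving action of $\mathbb Z^d$ on $\mathbb T^\nu$ (for instance by translations) such that, for some $C_0,B\in(0,\infty)$, $$\operatorname{dist}(\omega,T^x\omega)\ge C_0\|x\|^{-B}\qquad\text{for all }\omega\in\mathbb T^\nu,\ x\in\mathbb Z^d\setminus\{0\}.$$ For $n\ge1$ let $\{\mathbf C_{n,k}\}_{1\le k\le 2^{\nu n}}$ be the partition of $\mathbb T^\nu$ into the products of $\nu$ half-open arcs $[\frac{i-1}{2^n},\frac{i}{2^n})$, $1\le i\le 2^n$. Let $(a_n)_{n\ge1}$ be real numbers with $c''n^{-M}\le|a_n|\le c'n^{-\kappa}$ for all $n\ge 1$, where $c',c''>0$ and $1<\kappa\le M<\infty$. Let $\Theta=\prod_{n\ge1}[0,1]^{2^{\nu n}}$ with the product $\mu$ of the uniform distributions, so that the coordinates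 $\theta_{n,k}$ of $\theta\in\Theta$ are IID and uniform on $[0,1]$, and put $$v(\omega;\theta)=\sum_{n\ge1}a_n\sum_{k=1}^{2^{\nu n}}\theta_{n,k}\mathbf 1_{\mathbf C_{n,k}}(\omega),\qquad V(x;\omega;\theta)=v(T^x\omega;\theta).$$ Let $U:\mathbb Z^d\times\mathbb Z^d\to\mathbb R$ be a non-random interaction and consider on $\mathbb Z^{2d}$ the two-particle Hamiltonian $$\mathbf H(\omega;\theta)=\Delta_1+\Delta_2+V(x_1;\omega;\theta)+V(x_2;\omega;\theta)+U(x_1,x_2),$$ where $\Delta_j$ is the sum over the nearest neighbours in the variable $x_j$. For $\mathbf u=(u_1,u_2)\in\mathbb Z^{2d}$ and an integer $L\ge1$ let $\mathbf\Lambda_L(\mathbf u)=\Lambda_L(u_1)\times\Lambda_L(u_2)$, where $\Lambda_R(u)=\{x\in\mathbb Z^d:\|x-u\|\le R\}$, let $\Pi\mathbf\Lambda_L(\mathbf u)=\Lambda_L(u_1)\cup\Lambda_L(u_2)$, and let $\Sigma_{\mathbf u}(\omega;\theta)$ be the spectrum of the restriction of $\mathbf H(\omega;\theta)$ to $\mathbf\Lambda_L(\mathbf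 u)$ with Dirichlet boundary conditions. Let $S(u_1,u_2)=(u_2,u_1)$. **Theorem 2.** Let $b>0$ and $r>1$. There is a constant $\mathrm{Const}\in(0,\infty)$, independent of $L,\mathbf u',\mathbf u'',\theta,\epsilon$, with the following property. Let $L\ge1$ and $\mathbf u',\mathbf u''\in\mathbb Z^{2d}$ be such that $\Pi\mathbf\Lambda_L(\mathbf u')\subset\Lambda_{L^r}(v)$ for some $v\in\mathbb Z^d$, $$\|\mathbf u'-\mathbf u''\|\le L^r\qquad\text{and}\qquad\min\{\|\mathbf u''-\mathbf u'\|,\ \|\mathbf u''-S(\mathbf u')\|\}>8L.$$ Then there is a measurable set $\Theta_L\subset\Theta$ with $\mu(\Theta_L)\ge1-L^{-b}$ such that for every $\theta\in\Theta_L$ and every $\epsilon>0$ $$\mathbb P\{\omega\in\mathbb T^\nu:\ \operatorname{dist}[\Sigma_{\mathbf u'}(\omega;\theta),\Sigma_{\mathbf u''}(\omega;\theta)]\le\epsilon\}\le\mathrm{Const}\cdot L^{M+b+r+5d}\,\epsilon.$$ -/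

import Mathlib

open MeasureTheory

noncomputable section

namespace TwoParticle

/-! ### Lattice geometry -/

/-- The one-particle lattice `ℤ^d`. Its norm (and that of `ℤ^d × ℤ^d = ℤ^{2d}`) is the max-norm. -/
abbrev Lattice (d : ℕ) : Type := Fin d → ℤ

/-- The lattice cube `{x ∈ ℤ^d : ‖x - u‖ ≤ R}` with (real) radius `R` and center `u`. -/
def cube {d : ℕ} (R : ℝ) (u : Lattice d) : Finset (Lattice d) :=
  Finset.Icc (fun i => u i - ⌊R⌋) (fun i => u i + ⌊R⌋)

theorem mem_cube {d : ℕ} {R : ℝ} (hR : 0 ≤ R) (u x : Lattice d) :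
    x ∈ cube R u ↔ ‖x - u‖ ≤ R := by
  simp only [cube, Finset.mem_Icc, Pi.le_def, pi_norm_le_iff_of_nonneg hR, Pi.sub_apply,
    Int.norm_eq_abs]
  rw [← forall_and]
  refine forall_congr' fun i => ?_
  rw [show |((x i - u i : ℤ) : ℝ)| = ((|x i - u i| : ℤ) : ℝ) by push_cast; rfl,
    ← Int.le_floor, abs_le]
  constructor <;> rintro ⟨h1, h2⟩ <;> constructor <;> linarith

/-- The two-particle cube `Λ_L(u₁) × Λ_L(u₂)` in `ℤ^{2d}`. -/
def cube₂ {d : ℕ} (R : ℝ) (u : Lattice d × Lattice d) : Finset (Lattice d × Lattice d) :=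
  cube R u.1 ×ˢ cube R u.2

/-- The total shadow `Λ_L(u₁) ∪ Λ_L(u₂) ⊆ ℤ^d` of a two-particle cube. -/
def shadow {d : ℕ} (R : ℝ) (u : Lattice d × Lattice d) : Finset (Lattice d) :=
  cube R u.1 ∪ cube R u.2

/-- Nearest neighbours in `ℤ^d`. -/
def Neighbor {d : ℕ} (x y : Lattice d) : Prop := ∑ i, |x i - y i| = 1

/-! ### The randelette potential -/

/-- The dyadic cube of level `n` with multi-index `k` in the torus `𝕋^ν = (ℝ/ℤ)^ν`: the product
of the half-open arcs `[k_j / 2^n, (k_j + 1) / 2^n)`, `0 ≤ k_j < 2^n`. -/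
def dyadicCube {ν : ℕ} (n : ℕ+) (k : Fin ν → Fin (2 ^ (n : ℕ))) : Set (UnitAddTorus (Fin ν)) :=
  {ω | ∀ j, ω j ∈ (fun t : ℝ => (t : UnitAddCircle)) ''
    Set.Ico (((k j : ℕ) : ℝ) / 2 ^ (n : ℕ)) ((((k j : ℕ) : ℝ) + 1) / 2 ^ (n : ℕ))}

/-- The parameter space: all samples `(θ_{n,k})`, `n ≥ 1`, `k` an index of a level-`n` cube,
with values in `[0,1]`. -/
abbrev Param (ν : ℕ) : Type :=
  (Σ n : ℕ+, (Fin ν → Fin (2 ^ (n : ℕ)))) → unitInterval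

/-- The measure `μ` on the parameter space that makes the `θ_{n,k}` IID uniform on `[0,1]`. -/
def paramMeasure (ν : ℕ) : Measure (Param ν) :=
  Measure.infinitePi fun _ => (volume : Measure unitInterval)

/-- `v(ω;θ) = ∑_{n ≥ 1} a_n ∑_k θ_{n,k} 1_{C_{n,k}}(ω)`. -/
def randelette {ν : ℕ} (a : ℕ+ → ℝ) (ω : UnitAddTorus (Fin ν)) (θ : Param ν) : ℝ :=
  ∑' n : ℕ+, a n * ∑ k : Fin ν → Fin (2 ^ (n : ℕ)),
    (θ ⟨n, k⟩ : ℝ) * (dyadicCube n k).indicator (fun _ => (1 : ℝ)) ω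

/-- `V(x;ω;θ) = v(T^x ω;θ)`. -/
def potential {d ν : ℕ} (a : ℕ+ → ℝ)
    (T : Lattice d → UnitAddTorus (Fin ν) → UnitAddTorus (Fin ν))
    (ω : UnitAddTorus (Fin ν)) (θ : Param ν) (x : Lattice d) : ℝ :=
  randelette a (T x ω) θ

/-! ### The two-particle Hamiltonian -/

open Classical in
/-- The matrix elements of `H = Δ₁ + Δ₂ + V(x₁) + V(x₂) + U(x₁,x₂)` on `ℤ^d × ℤ^d`, where `Δ_j` is
the nearest-neighbour hopping operator (sum over nearest neighbours) in the variable `x_j`. -/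
def hamiltonianKernel {d : ℕ} (U : Lattice d × Lattice d → ℝ) (V : Lattice d → ℝ)
    (x y : Lattice d × Lattice d) : ℝ :=
  (if Neighbor x.1 y.1 ∧ x.2 = y.2 then 1 else 0) +
  (if x.1 = y.1 ∧ Neighbor x.2 y.2 then 1 else 0) +
  (if x = y then V x.1 + V x.2 + U x else 0)

/-- The restriction of `H` to the finite two-particle cube `Λ_R(u)` with Dirichlet boundary
conditions, as a finite symmetric matrix. -/
def hamiltonian {d : ℕ} (U : Lattice d × Lattice d → ℝ) (V : Lattice d → ℝ)
    (R : ℝ) (u : Lattice d × Lattice d) : Matrix (cube₂ R u) (cube₂ R u) ℝ :=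
  Matrix.of fun x y => hamiltonianKernel U V x y

open Classical in
/-- `Σ_{u,R}`: the set of eigenvalues of the finite-volume Hamiltonian. -/
def spec {d : ℕ} (U : Lattice d × Lattice d → ℝ) (V : Lattice d → ℝ)
    (R : ℝ) (u : Lattice d × Lattice d) : Set ℝ :=
  spectrum ℝ (hamiltonian U V R u)

/-- The distance `inf {|s - t| : s ∈ A, t ∈ B}` of two sets of reals
(here: finite, non-empty spectra). -/
def setDist (A B : Set ℝ) : ℝ := sInf (Set.image2 (fun s t => |s - t|) A B)

end TwoParticle

end

/-!
A Wegner estimate for the eigenvalue differences of two distant two-particle cubes: for all but a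
small set of `θ`, the spectra in the two cubes are within `ε` of each other only for a set of `ω` of
measure `O(ε)`, with the exceptional set of `θ` independent of `ε`.

**Shifts.** If the cubes are far apart modulo the exchange of the particles, then there is a set `Q`
of sites in which all configurations of the first cube have the same number `m'` of particles, and
all configurations of the second one the same number `m'' ≠ m'` (`exists_separating_set`).
Adding `t` to the potential on `Q` therefore translates all differences of eigenvalues by
`(m' - m'') * t` (`diffCount_shift`). The rest of the argument uses only this property of the
counting function of the differences, which is isolated in `IsShiftCount`.

**Fixed scale.** By the Diophantine condition, the points `T x ω` with `x` in the cubes lie in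
distinct dyadic cells of level `n`, as soon as `n` is a large multiple of `L`. Conditionally on all
other parameters, the values of the potential on `Q` then contain independent uniform variables of
amplitude `|a n|`. Since the diagonal shifts of these variables translate the differences of
eigenvalues, the expected number of differences in `[-h, h]` is at most of order `h / |a n|`. Hence
the average over the torus of this number, divided by `2 * h` (the `scaledCount`), has an expectation
bounded uniformly in `h` (`IsShiftCount.integral_scaledCount_le`), and by Markov's inequality it is
bounded outside of a small set of `θ`, which still depends on `h`.

**All scales.** It remains to exclude one set of `θ` for all `h = 2 ^ (-j)`. For `j ≤ L` a union bound
costs a factor `L + 1`, which the exponent `r > 1` absorbs. For `j > L` the scaled counts at the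
scales `2 * h` and `h` are compared in `L²(θ)`. The square of the difference is a double integral over
pairs `(ω, ω')`. Take a level `n` of order `L + j`. If the orbits of `ω` and `ω'` visit different
cells of the levels `n` and `n + 1`, then resampling these two layers along the orbit of `ω` alone
makes the expected count a Lipschitz function of the position of the interval, so that the increment
at `ω` has conditional expectation `O(h)`, up to powers of the amplitudes, independently of the
increment at `ω'` (`IsShiftCount.abs_integral_mul_le`). The other pairs have measure `O(2 ^ (-n))`,
and for `n ≥ 3 * j` this compensates the trivial bound `h⁻²`. As the amplitudes decay only polynomially
in `n`, the `L²` norms of the increments are summable in `j` (`exists_increment_bound`), and so the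
scaled counts are simultaneously bounded outside of one small set (`exists_forall_scaledCount_le`).
-/

namespace TwoParticle

/-! ### Counting eigenvalues in an interval -/

section EigenvalueCount

open Filter Topology Matrix

/-- The indicator function of the interval with endpoints `α ≤ β`, taking the value `1/2` at the
endpoints. With this convention the indicators of adjacent intervals add up exactly. -/
noncomputable def window (α β x : ℝ) : ℝ := (Real.sign (β - x) - Real.sign (α - x)) / 2

theorem window_add (α β γ x : ℝ) : window α β x + window β γ x = window α γ x := by
  unfold window; ring

theorem window_nonneg {α β : ℝ} (h : α ≤ β) (x : ℝ) : 0 ≤ window α β x := by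
  unfold window Real.sign
  split_ifs <;> linarith

theorem window_le_one (α β x : ℝ) : window α β x ≤ 1 := by
  unfold window Real.sign
  split_ifs <;> linarith

theorem half_le_window {α β x : ℝ} (h : α < β) (h₁ : α ≤ x) (h₂ : x ≤ β) :
    1 / 2 ≤ window α β x := by
  unfold window Real.sign
  split_ifs <;> linarith

/-- A rational approximation of the indicator function of an interval. -/
theorem tendsto_window {α β : ℝ} (h : α < β) (x : ℝ) :
    Tendsto (fun k : ℕ => (1 + (2 / (β - α) * (x - (α + β) / 2)) ^ (2 * k))⁻¹) atTop
      (𝓝 (window α β x)) := by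
  have hpos : 0 < β - α := sub_pos.2 h
  set y : ℝ := 2 / (β - α) * (x - (α + β) / 2) with hy
  have e1 : β - x = (β - α) / 2 * (1 - y) := by rw [hy]; field_simp; ring
  have e2 : α - x = -((β - α) / 2 * (1 + y)) := by rw [hy]; field_simp; ring
  have hc : 0 < (β - α) / 2 := by linarith
  have hsq : ∀ k : ℕ, y ^ (2 * k) = (y ^ 2) ^ k := fun k => pow_mul y 2 k
  simp only [hsq]
  rcases lt_trichotomy (|y|) 1 with hlt | heq | hgt
  · obtain ⟨hl, hr⟩ := abs_lt.1 hlt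
    have hw : window α β x = (1 + 0)⁻¹ := by
      unfold window
      rw [Real.sign_of_pos (e1 ▸ mul_pos hc (by linarith)),
        Real.sign_of_neg (e2 ▸ neg_neg_of_pos (mul_pos hc (by linarith)))]
      norm_num
    rw [hw]
    have : y ^ 2 < 1 := (sq_lt_one_iff_abs_lt_one y).2 hlt
    exact ((tendsto_pow_atTop_nhds_zero_of_lt_one (sq_nonneg y) this).const_add 1).inv₀ (by norm_num)
  · have hy1 : y ^ 2 = 1 := by rw [← sq_abs, heq, one_pow]
    have hw : window α β x = (1 + 1)⁻¹ := by
      unfold window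
      rcases eq_or_eq_neg_of_abs_eq heq with h1 | h1
      · rw [e1, e2, h1, Real.sign_of_neg (neg_neg_of_pos (mul_pos hc (by norm_num)))]
        norm_num
      · rw [e1, e2, h1, Real.sign_of_pos (mul_pos hc (by norm_num))]
        norm_num
    rw [hw]
    simp [hy1]
  · have hw : window α β x = 0 := by
      unfold window
      rcases lt_abs.1 hgt with h1 | h1
      · have : β - x < 0 := by rw [e1]; exact mul_neg_of_pos_of_neg hc (by linarith)
        rw [Real.sign_of_neg this, Real.sign_of_neg (by linarith)]; norm_num
      · have : 0 < α - x := by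
          rw [e2, ← mul_neg]; exact mul_pos hc (by linarith)
        rw [Real.sign_of_pos this, Real.sign_of_pos (by linarith)]; norm_num
    rw [hw]
    have : 1 < y ^ 2 := (one_lt_sq_iff_one_lt_abs y).2 hgt
    exact (tendsto_atTop_add_const_left _ 1 (tendsto_pow_atTop_atTop_of_one_lt this)).inv_tendsto_atTop

variable {n : Type*} [Fintype n] [DecidableEq n]

/-- The number of real eigenvalues of `A` between `α` and `β`, counted with multiplicity,
those at an endpoint contributing one half. -/
noncomputable def eigCount (α β : ℝ) (A : Matrix n n ℝ) : ℝ :=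
  (A.charpoly.roots.map (window α β)).sum

theorem eigCount_add (α β γ : ℝ) (A : Matrix n n ℝ) :
    eigCount α β A + eigCount β γ A = eigCount α γ A := by
  unfold eigCount
  rw [← Multiset.sum_map_add]
  simp only [window_add]

theorem eigCount_nonneg {α β : ℝ} (h : α ≤ β) (A : Matrix n n ℝ) : 0 ≤ eigCount α β A := by
  refine Multiset.sum_nonneg fun x hx => ?_
  obtain ⟨y, -, rfl⟩ := Multiset.mem_map.1 hx
  exact window_nonneg h y

theorem eigCount_le_card (α β : ℝ) (A : Matrix n n ℝ) : eigCount α β A ≤ Fintype.card n := by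
  have h := Multiset.sum_le_card_nsmul (A.charpoly.roots.map (window α β)) 1 (fun x hx => by
    obtain ⟨y, -, rfl⟩ := Multiset.mem_map.1 hx
    exact window_le_one α β y)
  rw [Multiset.card_map, nsmul_eq_mul, mul_one] at h
  refine h.trans (Nat.cast_le.2 ?_)
  simpa using Polynomial.card_roots' A.charpoly

theorem eigCount_add_scalar (α β t : ℝ) (A : Matrix n n ℝ) :
    eigCount α β (A + t • 1) = eigCount (α - t) (β - t) A := by
  have h := charpoly_sub_scalar (A + t • (1 : Matrix n n ℝ)) t
  have hs : A + t • (1 : Matrix n n ℝ) - scalar n t = A := by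
    rw [scalar_apply, ← smul_one_eq_diagonal, add_sub_cancel_right]
  rw [hs] at h
  have h2 := (A + t • (1 : Matrix n n ℝ)).charpoly.map_roots_comp_C_mul_X_add_C 1 t isUnit_one
  rw [Polynomial.C_1, one_mul, ← h] at h2
  unfold eigCount
  rw [← h2, Multiset.map_map]
  refine congrArg _ (Multiset.map_congr rfl fun x _ => ?_)
  simp only [Function.comp, window, one_mul]
  ring_nf

theorem half_le_eigCount {α β s : ℝ} (h : α < β) (h₁ : α ≤ s) (h₂ : s ≤ β) (A : Matrix n n ℝ)
    (hs : s ∈ spectrum ℝ A) : 1 / 2 ≤ eigCount α β A := by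
  have hroot : s ∈ A.charpoly.roots :=
    (Polynomial.mem_roots A.charpoly_monic.ne_zero).2 (mem_spectrum_iff_isRoot_charpoly.1 hs)
  refine (half_le_window h h₁ h₂).trans ?_
  refine Multiset.single_le_sum (fun x hx => ?_) _ (Multiset.mem_map_of_mem _ hroot)
  obtain ⟨y, -, rfl⟩ := Multiset.mem_map.1 hx
  exact window_nonneg h.le y

/-- For symmetric matrices the eigenvalue count is a limit of traces of rational functions. In this
form its dependence on the entries is visibly measurable. -/
theorem tendsto_trace_inv {α β : ℝ} (h : α < β) {A : Matrix n n ℝ} (hA : A.IsHermitian) :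
    Tendsto (fun k : ℕ => trace
      ((1 + ((2 / (β - α)) • (A - ((α + β) / 2) • (1 : Matrix n n ℝ))) ^ (2 * k))⁻¹)) atTop
      (𝓝 (eigCount α β A)) := by
  have hcount : eigCount α β A = ∑ i, window α β (hA.eigenvalues i) := by
    unfold eigCount
    rw [hA.roots_charpoly_eq_eigenvalues, Multiset.map_map]
    rfl
  rw [hcount]
  have htr : ∀ k : ℕ, trace
      ((1 + ((2 / (β - α)) • (A - ((α + β) / 2) • (1 : Matrix n n ℝ))) ^ (2 * k))⁻¹) =
      ∑ i, (1 + (2 / (β - α) * (hA.eigenvalues i - (α + β) / 2)) ^ (2 * k))⁻¹ := by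
    intro k
    set Φ := Unitary.conjStarAlgAut ℝ (Matrix n n ℝ) hA.eigenvectorUnitary
    have hspec : A = Φ (diagonal hA.eigenvalues) := hA.spectral_theorem
    set g : n → ℝ := fun i => 1 + (2 / (β - α) * (hA.eigenvalues i - (α + β) / 2)) ^ (2 * k) with hg
    have hg0 : ∀ i, g i ≠ 0 := fun i => by
      have : 0 ≤ (2 / (β - α) * (hA.eigenvalues i - (α + β) / 2)) ^ (2 * k) :=
        (even_two_mul k).pow_nonneg _
      simp only [hg]; linarith
    have hone : 1 + ((2 / (β - α)) • (A - ((α + β) / 2) • (1 : Matrix n n ℝ))) ^ (2 * k) =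
        Φ (diagonal g) := by
      have hd : diagonal g = 1 + ((2 / (β - α)) • (diagonal hA.eigenvalues -
          ((α + β) / 2) • (1 : Matrix n n ℝ))) ^ (2 * k) := by
        rw [smul_one_eq_diagonal, diagonal_sub, ← diagonal_smul, diagonal_pow, ← diagonal_one,
          diagonal_add]
        rfl
      rw [hd, map_add, map_one, map_pow, map_smul, map_sub, map_smul, map_one, ← hspec]
    have hinv : (Φ (diagonal g))⁻¹ = Φ (diagonal fun i => (g i)⁻¹) := by
      refine inv_eq_right_inv ?_
      rw [← map_mul, diagonal_mul_diagonal]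
      simp [hg0]
    rw [hone, hinv, Unitary.conjStarAlgAut_apply, trace_mul_cycle]
    simp [trace_diagonal, hg]
  simp only [htr]
  exact tendsto_finsetSum _ fun i _ => tendsto_window h _

theorem measurable_eigCount {X : Type*} [MeasurableSpace X] {α β : ℝ} (h : α ≤ β)
    {A : X → Matrix n n ℝ} (hA : ∀ x, (A x).IsHermitian)
    (hm : ∀ i j, Measurable fun x => A x i j) : Measurable fun x => eigCount α β (A x) := by
  rcases h.eq_or_lt with rfl | h
  · have h0 : window α α = fun _ => 0 := funext fun x => by simp [window]
    simp [eigCount, h0]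
  refine measurable_of_tendsto_metrizable (f := fun (k : ℕ) x => trace
      ((1 + ((2 / (β - α)) • (A x - ((α + β) / 2) • (1 : Matrix n n ℝ))) ^ (2 * k))⁻¹)) ?_
    (tendsto_pi_nhds.2 fun x => tendsto_trace_inv h (hA x))
  intro k
  have hcomp : Measurable fun B : n → n → ℝ => trace
      ((1 + ((2 / (β - α)) • (Matrix.of B - ((α + β) / 2) • (1 : Matrix n n ℝ))) ^ (2 * k))⁻¹) := by
    have hof : Continuous fun B : n → n → ℝ =>
        (1 + ((2 / (β - α)) • (Matrix.of B - ((α + β) / 2) • (1 : Matrix n n ℝ))) ^ (2 * k)) := by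
      have : Continuous fun B : n → n → ℝ => (Matrix.of B : Matrix n n ℝ) := continuous_id
      fun_prop
    simp only [trace, inv_def, diag_apply, Matrix.smul_apply, Ring.inverse_eq_inv', smul_eq_mul]
    refine Finset.measurable_sum _ fun i _ => ?_
    exact hof.matrix_det.measurable.inv.mul
      ((hof.matrix_adjugate.matrix_elem i i).measurable)
  have hB : Measurable fun x => (fun i j => A x i j) := by
    exact measurable_pi_iff.2 fun i => measurable_pi_iff.2 fun j => hm i j
  exact hcomp.comp hB

end EigenvalueCount

/-! ### Differences of eigenvalues of two finite-volume Hamiltonians -/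

section EigenvalueDifferences

open Matrix
open scoped Kronecker

theorem exists_eigenvector_of_mem_spectrum {n : Type*} [Fintype n] [DecidableEq n]
    {A : Matrix n n ℝ} {s : ℝ} (hs : s ∈ spectrum ℝ A) : ∃ v ≠ 0, A *ᵥ v = s • v := by
  rw [← spectrum_toLin', ← Module.End.hasEigenvalue_iff_mem_spectrum] at hs
  obtain ⟨v, hv⟩ := hs.exists_hasEigenvector
  exact ⟨v, hv.2, by simpa using hv.apply_eq_smul⟩

theorem mem_spectrum_of_eigenvector {n : Type*} [Fintype n] [DecidableEq n]
    {A : Matrix n n ℝ} {s : ℝ} {v : n → ℝ} (hv : v ≠ 0) (h : A *ᵥ v = s • v) :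
    s ∈ spectrum ℝ A := by
  rw [← spectrum_toLin', ← Module.End.hasEigenvalue_iff_mem_spectrum]
  exact Module.End.hasEigenvalue_of_hasEigenvector
    (Module.End.hasEigenvector_iff.2 ⟨Module.End.mem_eigenspace_iff.2 (by simpa using h), hv⟩)

/-- The eigenvalues of `A ⊗ 1 - 1 ⊗ B` include all differences of an eigenvalue of `A` and an
eigenvalue of `B`. -/
theorem sub_mem_spectrum_kronecker {n m : Type*} [Fintype n] [DecidableEq n] [Fintype m]
    [DecidableEq m] {A : Matrix n n ℝ} {B : Matrix m m ℝ} {s t : ℝ} (hs : s ∈ spectrum ℝ A)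
    (ht : t ∈ spectrum ℝ B) : s - t ∈ spectrum ℝ (A ⊗ₖ (1 : Matrix m m ℝ) - (1 : Matrix n n ℝ) ⊗ₖ B) := by
  obtain ⟨v, hv, hAv⟩ := exists_eigenvector_of_mem_spectrum hs
  obtain ⟨w, hw, hBw⟩ := exists_eigenvector_of_mem_spectrum ht
  obtain ⟨i, hi⟩ := Function.ne_iff.1 hv
  obtain ⟨j, hj⟩ := Function.ne_iff.1 hw
  refine mem_spectrum_of_eigenvector (v := fun p => v p.1 * w p.2)
    (Function.ne_iff.2 ⟨(i, j), mul_ne_zero hi hj⟩) ?_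
  have h1 : ∀ i, ∑ k, A i k * v k = s * v i := fun i => congrFun hAv i
  have h2 : ∀ j, ∑ k, B j k * w k = t * w j := fun j => congrFun hBw j
  ext ⟨i, j⟩
  have e1 : ((A ⊗ₖ (1 : Matrix m m ℝ)) *ᵥ fun p => v p.1 * w p.2) (i, j) = s * v i * w j := by
    rw [← h1, Finset.sum_mul]
    simp only [mulVec, dotProduct, Fintype.sum_prod_type, kronecker_apply, one_apply]
    refine Finset.sum_congr rfl fun k _ => ?_
    simp [mul_assoc]
  have e2 : (((1 : Matrix n n ℝ) ⊗ₖ B) *ᵥ fun p => v p.1 * w p.2) (i, j) = v i * (t * w j) := by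
    rw [← h2, Finset.mul_sum]
    simp only [mulVec, dotProduct, Fintype.sum_prod_type_right, kronecker_apply, one_apply]
    refine Finset.sum_congr rfl fun k _ => ?_
    simp
    ring
  rw [sub_mulVec, Pi.sub_apply, e1, e2]
  simp only [Pi.smul_apply, smul_eq_mul]
  ring

variable {d : ℕ}

theorem Neighbor.symm_iff {x y : Lattice d} : Neighbor x y ↔ Neighbor y x := by
  unfold Neighbor
  simp only [abs_sub_comm]

theorem hamiltonian_isHermitian (U : Lattice d × Lattice d → ℝ) (V : Lattice d → ℝ) (R : ℝ)
    (u : Lattice d × Lattice d) : (hamiltonian U V R u).IsHermitian := by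
  classical
  refine IsHermitian.ext fun x y => ?_
  simp only [hamiltonian, of_apply, hamiltonianKernel, star_trivial]
  congr 1
  · congr 1
    · exact if_congr (by rw [Neighbor.symm_iff, eq_comm]) rfl rfl
    · exact if_congr (by rw [Neighbor.symm_iff, eq_comm]) rfl rfl
  · by_cases h : x = y
    · subst h; rfl
    · rw [if_neg (fun h' => h (Subtype.ext h').symm), if_neg (fun h' => h (Subtype.ext h'))]

/-- The finite-volume Hamiltonian depends on the potential only through its values at the sites of
the shadow. -/
theorem hamiltonian_congr {U : Lattice d × Lattice d → ℝ} {V V' : Lattice d → ℝ} {R : ℝ}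
    {u : Lattice d × Lattice d} (h : ∀ x ∈ shadow R u, V x = V' x) :
    hamiltonian U V R u = hamiltonian U V' R u := by
  ext x y
  have hx := Finset.mem_product.1 x.2
  simp only [hamiltonian, of_apply, hamiltonianKernel,
    h _ (Finset.mem_union_left _ hx.1), h _ (Finset.mem_union_right _ hx.2)]

/-- The number of particles of the configuration `x` in `Q`. -/
def occupation (Q : Finset (Lattice d)) (x : Lattice d × Lattice d) : ℝ :=
  (if x.1 ∈ Q then 1 else 0) + (if x.2 ∈ Q then 1 else 0)

/-- If all configurations of the cube have `m` particles in `Q`, then adding `t` to the potential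
on `Q` adds `m * t` to the Hamiltonian. -/
theorem hamiltonian_shift {U : Lattice d × Lattice d → ℝ} {V : Lattice d → ℝ} {R : ℝ}
    {u : Lattice d × Lattice d} {Q : Finset (Lattice d)} {m : ℝ}
    (h : ∀ x ∈ cube₂ R u, occupation Q x = m) (t : ℝ) :
    hamiltonian U (fun x => V x + if x ∈ Q then t else 0) R u =
      hamiltonian U V R u + (m * t) • (1 : Matrix (cube₂ R u) (cube₂ R u) ℝ) := by
  ext x y
  have hx := h x x.2
  unfold occupation at hx
  simp only [hamiltonian, of_apply, hamiltonianKernel, Matrix.add_apply, Matrix.smul_apply,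
    one_apply, Subtype.ext_iff, ← hx, smul_eq_mul]
  split_ifs <;> ring

theorem measurable_hamiltonian_apply (U : Lattice d × Lattice d → ℝ) (R : ℝ)
    (u : Lattice d × Lattice d) (x y : cube₂ R u) :
    Measurable fun V : Lattice d → ℝ => hamiltonian U V R u x y := by
  simp only [hamiltonian, of_apply, hamiltonianKernel]
  refine Measurable.const_add ?_ _
  split_ifs <;> fun_prop

/-- The number of pairs of eigenvalues `(s, t)` of the Hamiltonians in the cubes `u'` and `u''`
with `s - t` between `α` and `β`. It is encoded as an eigenvalue count of `H' ⊗ 1 - 1 ⊗ H''`. -/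
noncomputable def diffCount (U : Lattice d × Lattice d → ℝ) (R : ℝ) (u' u'' : Lattice d × Lattice d)
    (α β : ℝ) (V : Lattice d → ℝ) : ℝ :=
  eigCount α β (hamiltonian U V R u' ⊗ₖ (1 : Matrix (cube₂ R u'') (cube₂ R u'') ℝ) -
    (1 : Matrix (cube₂ R u') (cube₂ R u') ℝ) ⊗ₖ hamiltonian U V R u'')

variable (U : Lattice d × Lattice d → ℝ) (R : ℝ) (u' u'' : Lattice d × Lattice d)

theorem diffCount_add (α β γ : ℝ) (V : Lattice d → ℝ) :
    diffCount U R u' u'' α β V + diffCount U R u' u'' β γ V = diffCount U R u' u'' α γ V :=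
  eigCount_add _ _ _ _

theorem diffCount_nonneg {α β : ℝ} (h : α ≤ β) (V : Lattice d → ℝ) :
    0 ≤ diffCount U R u' u'' α β V :=
  eigCount_nonneg h _

theorem diffCount_le (α β : ℝ) (V : Lattice d → ℝ) :
    diffCount U R u' u'' α β V ≤ (cube₂ R u').card * (cube₂ R u'').card := by
  refine (eigCount_le_card _ _ _).trans ?_
  simp

theorem measurable_diffCount {α β : ℝ} (h : α ≤ β) : Measurable (diffCount U R u' u'' α β) := by
  refine measurable_eigCount h (fun V => ?_) fun i j => ?_
  · refine IsHermitian.sub ?_ ?_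
    · rw [IsHermitian, conjTranspose_kronecker, (hamiltonian_isHermitian U V R u').eq,
        conjTranspose_one]
    · rw [IsHermitian, conjTranspose_kronecker, (hamiltonian_isHermitian U V R u'').eq,
        conjTranspose_one]
  · simp only [Matrix.sub_apply]
    exact ((measurable_hamiltonian_apply U R u' _ _).mul_const _).sub
      ((measurable_hamiltonian_apply U R u'' _ _).const_mul _)

theorem diffCount_congr {α β : ℝ} {V V' : Lattice d → ℝ}
    (h : ∀ x ∈ shadow R u' ∪ shadow R u'', V x = V' x) :
    diffCount U R u' u'' α β V = diffCount U R u' u'' α β V' := by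
  unfold diffCount
  rw [hamiltonian_congr fun x hx => h x (Finset.mem_union_left _ hx),
    hamiltonian_congr fun x hx => h x (Finset.mem_union_right _ hx)]

variable {R u' u''} in
/-- When `Q` contains `m'` particles of each configuration of the first cube and `m''` particles of
each configuration of the second one, a shift of the potential on `Q` translates all differences
of eigenvalues. -/
theorem diffCount_shift {Q : Finset (Lattice d)} {m' m'' : ℝ}
    (h' : ∀ x ∈ cube₂ R u', occupation Q x = m') (h'' : ∀ x ∈ cube₂ R u'', occupation Q x = m'')
    (α β t : ℝ) (V : Lattice d → ℝ) :
    diffCount U R u' u'' α β (fun x => V x + if x ∈ Q then t else 0) =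
      diffCount U R u' u'' (α - (m' - m'') * t) (β - (m' - m'') * t) V := by
  unfold diffCount
  rw [hamiltonian_shift h', hamiltonian_shift h'', ← eigCount_add_scalar]
  congr 1
  rw [add_kronecker, kronecker_add, smul_kronecker, kronecker_smul, one_kronecker_one, sub_mul,
    sub_smul]
  abel

theorem cube₂_nonempty {R : ℝ} (hR : 0 ≤ R) (u : Lattice d × Lattice d) :
    (cube₂ R u).Nonempty :=
  ⟨u, Finset.mem_product.2 ⟨(mem_cube hR _ _).2 (by simpa using hR),
    (mem_cube hR _ _).2 (by simpa using hR)⟩⟩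

variable {R} in
/-- If the two spectra come closer than `h`, then there is a difference of eigenvalues between `-h`
and `h`, which the count sees with weight at least one half. -/
theorem half_le_diffCount (hR : 0 ≤ R) {h : ℝ} (hh : 0 < h) (V : Lattice d → ℝ)
    (hd : setDist (spec U V R u') (spec U V R u'') ≤ h) :
    1 / 2 ≤ diffCount U R u' u'' (-h) h V := by
  have hfin : ∀ u, (spec U V R u).Finite := fun u => finite_real_spectrum
  have hne : ∀ u, (spec U V R u).Nonempty := fun u => by
    have : Nonempty (cube₂ R u) := (cube₂_nonempty hR u).to_subtype
    obtain ⟨i⟩ := this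
    exact ⟨_, (hamiltonian_isHermitian U V R u).eigenvalues_mem_spectrum_real i⟩
  -- the infimum is attained because both spectra are finite and non-empty
  obtain ⟨s, hs, t, ht, hst⟩ : setDist (spec U V R u') (spec U V R u'') ∈
      Set.image2 (fun s t => |s - t|) (spec U V R u') (spec U V R u'') :=
    ((hne u').image2 (hne u'')).csInf_mem ((hfin u').image2 _ (hfin u''))
  have hst' : |s - t| ≤ h := hst.le.trans hd
  obtain ⟨h1, h2⟩ := abs_le.1 hst'
  exact half_le_eigCount (by linarith) h1 h2 _ (sub_mem_spectrum_kronecker hs ht)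

end EigenvalueDifferences

/-! ### Geometry of pairs of two-particle cubes -/

section Geometry

variable {d : ℕ}

theorem card_cube_natCast (L : ℕ) (u : Lattice d) : (cube (L : ℝ) u).card = (2 * L + 1) ^ d := by
  have h : ∀ i, (u i + (L : ℤ) + 1 - (u i - L)).toNat = 2 * L + 1 := fun i => by omega
  simp only [cube, Pi.card_Icc, Int.card_Icc, Int.floor_natCast, h]
  simp

theorem card_cube₂_natCast (L : ℕ) (u : Lattice d × Lattice d) :
    (cube₂ (L : ℝ) u).card = ((2 * L + 1) ^ d) ^ 2 := by
  rw [cube₂, Finset.card_product, card_cube_natCast, card_cube_natCast, sq]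

theorem card_shadow_natCast_le (L : ℕ) (u : Lattice d × Lattice d) :
    (shadow (L : ℝ) u).card ≤ 2 * (2 * L + 1) ^ d := by
  refine (Finset.card_union_le _ _).trans ?_
  rw [card_cube_natCast, card_cube_natCast, ← two_mul]

/-- The four centres of the one-particle cubes, as vertices of a graph in which two of them are
joined when their cubes of radius `L` may intersect. -/
def overlapGraph (L : ℝ) (c : Fin 4 → Lattice d) : SimpleGraph (Fin 4) where
  Adj i j := i ≠ j ∧ ‖c i - c j‖ ≤ 2 * L
  symm := ⟨fun i j h => ⟨h.1.symm, by rw [norm_sub_rev]; exact h.2⟩⟩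
  loopless := ⟨fun i h => h.1 rfl⟩

theorem norm_sub_le_of_reachable {L : ℝ} (hL : 0 ≤ L) {c : Fin 4 → Lattice d} {i j : Fin 4}
    (h : (overlapGraph L c).Reachable i j) : ‖c i - c j‖ ≤ 6 * L := by
  have key : ∀ {i j : Fin 4} (p : (overlapGraph L c).Walk i j),
      ‖c i - c j‖ ≤ 2 * L * p.length := by
    intro i j p
    induction p with
    | nil => simp
    | cons h p ih =>
      rw [SimpleGraph.Walk.length_cons]
      push_cast
      have := norm_sub_le_norm_sub_add_norm_sub (c _) (c _) (c _) |>.trans (add_le_add h.2 ih)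
      linarith
  obtain ⟨p, hp⟩ := h.exists_isPath
  have hlen : p.length < 4 := by simpa using hp.length_lt
  have : (p.length : ℝ) ≤ 3 := by exact_mod_cast Nat.lt_succ_iff.1 hlen
  calc ‖c i - c j‖ ≤ 2 * L * p.length := key p
    _ ≤ 2 * L * 3 := by gcongr
    _ = 6 * L := by ring

/-- Two two-particle cubes that are far apart modulo the exchange of the particles are separated by
a set of sites `Q` in which they have constant and different numbers of particles. It is the union
of the one-particle cubes of a cluster of overlapping cubes. -/
theorem exists_separating_set (L : ℕ) (u' u'' : Lattice d × Lattice d)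
    (h : 8 * (L : ℝ) < min ‖u'' - u'‖ ‖u'' - u'.swap‖) :
    ∃ (Q : Finset (Lattice d)) (m' m'' : ℝ), 1 ≤ |m' - m''| ∧
      Q ⊆ shadow (L : ℝ) u' ∪ shadow (L : ℝ) u'' ∧
      (∀ x ∈ cube₂ (L : ℝ) u', occupation Q x = m') ∧
      (∀ x ∈ cube₂ (L : ℝ) u'', occupation Q x = m'') := by
  classical
  have hL : (0 : ℝ) ≤ L := Nat.cast_nonneg L
  set c : Fin 4 → Lattice d := ![u'.1, u'.2, u''.1, u''.2] with hc
  set G := overlapGraph (L : ℝ) c with hG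
  set Q : Fin 4 → Finset (Lattice d) := fun i =>
    (Finset.univ.filter fun j => G.Reachable i j).biUnion fun j => cube (L : ℝ) (c j) with hQ
  -- a one-particle cube is contained in the union over a cluster or disjoint from it
  have hmem : ∀ i j, ∀ x ∈ cube (L : ℝ) (c j), (x ∈ Q i ↔ G.Reachable i j) := by
    intro i j x hx
    simp only [hQ, Finset.mem_biUnion, Finset.mem_filter, Finset.mem_univ, true_and]
    refine ⟨fun ⟨k, hk, hxk⟩ => ?_, fun hr => ⟨j, hr, hx⟩⟩
    by_cases hkj : k = j
    · exact hkj ▸ hk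
    · refine hk.trans (SimpleGraph.Adj.reachable ⟨hkj, ?_⟩)
      rw [mem_cube hL] at hx hxk
      have := norm_sub_le_norm_sub_add_norm_sub (c k) x (c j)
      rw [norm_sub_rev (c k) x] at this
      linarith
  have hocc' : ∀ i, ∀ x ∈ cube₂ (L : ℝ) u', occupation (Q i) x =
      (if G.Reachable i 0 then 1 else 0) + (if G.Reachable i 1 then 1 else 0) := by
    intro i x hx
    obtain ⟨h1, h2⟩ := Finset.mem_product.1 hx
    simp only [occupation, hmem i 0 x.1 h1, hmem i 1 x.2 h2]
  have hocc'' : ∀ i, ∀ x ∈ cube₂ (L : ℝ) u'', occupation (Q i) x =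
      (if G.Reachable i 2 then 1 else 0) + (if G.Reachable i 3 then 1 else 0) := by
    intro i x hx
    obtain ⟨h1, h2⟩ := Finset.mem_product.1 hx
    simp only [occupation, hmem i 2 x.1 h1, hmem i 3 x.2 h2]
  have hsub : ∀ i, Q i ⊆ shadow (L : ℝ) u' ∪ shadow (L : ℝ) u'' := by
    intro i x hx
    simp only [hQ, Finset.mem_biUnion] at hx
    obtain ⟨j, -, hj⟩ := hx
    simp only [shadow, Finset.mem_union]
    fin_cases j <;> simp [hc] at hj <;> simp [hj]
  by_contra hcon
  -- otherwise each cluster has as many vertices from `u'` as from `u''`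
  have hbal : ∀ i, ((if G.Reachable i 0 then 1 else 0) + (if G.Reachable i 1 then 1 else 0) : ℝ) =
      (if G.Reachable i 2 then 1 else 0) + (if G.Reachable i 3 then 1 else 0) := by
    intro i
    by_contra hne
    refine hcon ⟨Q i, _, _, ?_, hsub i, hocc' i, hocc'' i⟩
    revert hne
    split_ifs <;> norm_num
  have far1 : ¬ (G.Reachable 0 2 ∧ G.Reachable 1 3) := by
    rintro ⟨h1, h2⟩
    have e1 := norm_sub_le_of_reachable hL h1
    have e2 := norm_sub_le_of_reachable hL h2
    have : ‖u'' - u'‖ ≤ 6 * L := by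
      rw [norm_sub_rev, Prod.norm_def]
      exact max_le e1 e2
    have := h.trans_le (min_le_left _ _)
    linarith
  have far2 : ¬ (G.Reachable 0 3 ∧ G.Reachable 1 2) := by
    rintro ⟨h1, h2⟩
    have e1 := norm_sub_le_of_reachable hL h1
    have e2 := norm_sub_le_of_reachable hL h2
    have : ‖u'' - u'.swap‖ ≤ 6 * L := by
      rw [norm_sub_rev, Prod.norm_def]
      exact max_le e2 e1
    have := h.trans_le (min_le_right _ _)
    linarith
  have b0 := hbal 0
  have b1 := hbal 1
  have r00 : G.Reachable 0 0 := SimpleGraph.Reachable.refl _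
  have r11 : G.Reachable 1 1 := SimpleGraph.Reachable.refl _
  have t1 : G.Reachable 0 2 → G.Reachable 1 2 → G.Reachable 0 1 := fun a b => a.trans b.symm
  have t2 : G.Reachable 0 3 → G.Reachable 1 3 → G.Reachable 0 1 := fun a b => a.trans b.symm
  have t3 : G.Reachable 0 1 ↔ G.Reachable 1 0 := SimpleGraph.reachable_comm
  have logic : ∀ P A B : Prop, [Decidable P] → [Decidable A] → [Decidable B] →
      (1 : ℝ) + (if P then 1 else 0) = (if A then 1 else 0) + (if B then 1 else 0) →
      (P → A ∧ B) ∧ (A ∨ B) := by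
    intro P A B _ _ _ hPAB
    split_ifs at hPAB <;> first | (exfalso; linarith) | tauto
  simp only [r00, r11, if_true] at b0 b1
  rw [add_comm] at b1
  have l0 := logic _ _ _ b0
  have l1 := logic _ _ _ b1
  by_cases h01 : G.Reachable 0 1
  · exact far1 ⟨(l0.1 h01).1, (l1.1 (t3.1 h01)).2⟩
  · rcases l0.2 with e0 | e0 <;> rcases l1.2 with e1 | e1
    exacts [h01 (t1 e0 e1), far1 ⟨e0, e1⟩, far2 ⟨e0, e1⟩, h01 (t2 e0 e1)]

/-- All sites of the two shadows lie in one cube of radius `3 L ^ r`. -/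
theorem norm_sub_le_of_mem_shadow {L : ℕ} (hL : 1 ≤ L) {r : ℝ} (hr : 1 ≤ r)
    {u' u'' : Lattice d × Lattice d} {v : Lattice d}
    (hv : shadow (L : ℝ) u' ⊆ cube ((L : ℝ) ^ r) v) (hu : ‖u' - u''‖ ≤ (L : ℝ) ^ r)
    {x y : Lattice d} (hx : x ∈ shadow (L : ℝ) u' ∪ shadow (L : ℝ) u'')
    (hy : y ∈ shadow (L : ℝ) u' ∪ shadow (L : ℝ) u'') : ‖x - y‖ ≤ 6 * (L : ℝ) ^ r := by
  have hL0 : (0 : ℝ) ≤ L := Nat.cast_nonneg L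
  have hLr : (L : ℝ) ≤ (L : ℝ) ^ r := by
    simpa using Real.rpow_le_rpow_of_exponent_le (Nat.one_le_cast.2 hL) hr
  have hLr0 : (0 : ℝ) ≤ (L : ℝ) ^ r := hL0.trans hLr
  have hself : ∀ w : Lattice d, w ∈ cube (L : ℝ) w := fun w => (mem_cube hL0 _ _).2 (by simp)
  have hc1 : ‖u'.1 - v‖ ≤ (L : ℝ) ^ r :=
    (mem_cube hLr0 _ _).1 (hv (Finset.mem_union_left _ (hself _)))
  have hc2 : ‖u'.2 - v‖ ≤ (L : ℝ) ^ r :=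
    (mem_cube hLr0 _ _).1 (hv (Finset.mem_union_right _ (hself _)))
  have hd1 : ‖u''.1 - u'.1‖ ≤ (L : ℝ) ^ r := by
    rw [norm_sub_rev]; exact (norm_fst_le (u' - u'')).trans hu
  have hd2 : ‖u''.2 - u'.2‖ ≤ (L : ℝ) ^ r := by
    rw [norm_sub_rev]; exact (norm_snd_le (u' - u'')).trans hu
  have key : ∀ x ∈ shadow (L : ℝ) u' ∪ shadow (L : ℝ) u'', ‖x - v‖ ≤ 3 * (L : ℝ) ^ r := by
    intro x hx
    rcases Finset.mem_union.1 hx with hx | hx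
    · have := (mem_cube hLr0 _ _).1 (hv hx)
      linarith
    · rcases Finset.mem_union.1 hx with hx | hx
      · have h0 := (mem_cube hL0 _ _).1 hx
        have h1 := norm_sub_le_norm_sub_add_norm_sub x u''.1 v
        have h2 := norm_sub_le_norm_sub_add_norm_sub u''.1 u'.1 v
        linarith
      · have h0 := (mem_cube hL0 _ _).1 hx
        have h1 := norm_sub_le_norm_sub_add_norm_sub x u''.2 v
        have h2 := norm_sub_le_norm_sub_add_norm_sub u''.2 u'.2 v
        linarith
  have h1 := norm_sub_le_norm_sub_add_norm_sub x v y
  rw [norm_sub_rev v y] at h1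
  linarith [key x hx, key y hy]

end Geometry

/-! ### Averages over unit cubes -/

section CubeAverages

variable {ι : Type*} [Fintype ι]

/-- The distribution of a finite family of independent uniform variables on `[0,1]`. -/
noncomputable abbrev uniformPi (ι : Type*) [Fintype ι] : Measure (ι → unitInterval) :=
  Measure.pi fun _ => volume

/-- The unit cube of `ℝ^ι`. -/
def unitBox (ι : Type*) : Set (ι → ℝ) := Set.univ.pi fun _ => Set.Icc 0 1

theorem measurableSet_unitBox : MeasurableSet (unitBox ι) :=
  MeasurableSet.univ_pi fun _ => measurableSet_Icc

theorem volume_box (p q : ℝ) :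
    volume (Set.univ.pi fun _ : ι => Set.Icc p q) = ENNReal.ofReal (q - p) ^ Fintype.card ι := by
  rw [volume_pi_pi]
  simp [Real.volume_Icc]

theorem integral_uniformPi {f : (ι → ℝ) → ℝ} (hf : Measurable f) :
    ∫ ξ, f (fun i => (ξ i : ℝ)) ∂uniformPi ι = ∫ x in unitBox ι, f x := by
  have h1 : MeasurePreserving (Subtype.val : unitInterval → ℝ) volume
      (volume.restrict (Set.Icc 0 1)) := measurePreserving_subtype_coe measurableSet_Icc
  have h2 := measurePreserving_pi (fun _ : ι => (volume : Measure unitInterval))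
    (fun _ : ι => (volume.restrict (Set.Icc (0 : ℝ) 1))) (fun _ => h1)
  have h3 : Measure.pi (fun _ : ι => (volume.restrict (Set.Icc (0 : ℝ) 1))) =
      volume.restrict (unitBox ι) := by
    rw [unitBox, volume_pi, Measure.restrict_pi_pi]
  rw [h3] at h2
  rw [← h2.map_eq, integral_map h2.measurable.aemeasurable hf.aestronglyMeasurable]

/-- An averaging estimate that plays the role of a Wegner bound: if at each point the sum of `f`
along an arithmetic progression in the diagonal direction is at most `P`, then the averages of `f`
over cubes of side `a` are at most of order `P` times the ratio of the step to `a`, times the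
dimension. The dimension enters since diagonals of a slightly larger cube are used. -/
theorem integral_uniformPi_le_of_sum_shift_le [Nonempty ι] {f : (ι → ℝ) → ℝ} (hf : Measurable f)
    (h0 : ∀ x, 0 ≤ f x) {P τ a : ℝ} (hτ : τ ≠ 0) (ha : a ≠ 0)
    (hsum : ∀ (J : ℕ) (x : ι → ℝ), ∑ l ∈ Finset.range J, f (fun i => x i + l * τ) ≤ P)
    (v : ι → ℝ) :
    ∫ ξ, f (fun i => v i + a * (ξ i : ℝ)) ∂uniformPi ι ≤
      6 * P * Fintype.card ι * |τ| / |a| := by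
  set g : (ι → ℝ) → ℝ := fun x => f (fun i => v i + a * x i) with hg
  have hgm : Measurable g := hf.comp (by fun_prop)
  have hP1 : ∀ x, f x ≤ P := fun x => by simpa using hsum 1 x
  have hP : 0 ≤ P := (h0 0).trans (hP1 0)
  set s : ℝ := |τ| / |a| with hs
  have hspos : 0 < s := div_pos (abs_pos.2 hτ) (abs_pos.2 ha)
  have hsumg : ∀ (J : ℕ) (x : ι → ℝ), ∑ l ∈ Finset.range J, g (fun i => x i + l * s) ≤ P := by
    intro J x
    have has : |a * s| = |τ| := by
      rw [abs_mul, abs_of_pos hspos, hs, mul_div_cancel₀ _ (abs_ne_zero.2 ha)]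
    rcases abs_eq_abs.1 has with h | h
    · refine le_trans (le_of_eq ?_) (hsum J fun i => v i + a * x i)
      refine Finset.sum_congr rfl fun l _ => congrArg f (funext fun i => ?_)
      rw [← h]; ring
    · cases J with
      | zero => simpa using hP
      | succ k =>
        refine le_trans (le_of_eq ?_) (hsum (k + 1) fun i => v i + a * x i - k * τ)
        rw [← Finset.sum_range_reflect]
        refine Finset.sum_congr rfl fun l hl => congrArg f (funext fun i => ?_)
        have hl' : l ≤ k := Nat.lt_succ_iff.1 (Finset.mem_range.1 hl)
        rw [Nat.add_sub_cancel, Nat.cast_sub hl']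
        have : a * ((k - l : ℝ) * s) = -((k - l : ℝ) * τ) := by
          rw [mul_left_comm, h]; ring
        rw [mul_add, this]; ring
  have hint : ∀ (l : ℝ) (S : Set (ι → ℝ)), MeasurableSet S → volume S ≠ ⊤ →
      Integrable (S.indicator fun x => g fun i => x i + l) := by
    intro l S hS hfin
    refine IntegrableOn.integrable_indicator ?_ hS
    refine Measure.integrableOn_of_bounded (M := P) hfin
      (hgm.comp (by fun_prop)).aestronglyMeasurable (ae_of_all _ fun x => ?_)
    rw [Real.norm_eq_abs, abs_of_nonneg (h0 _)]
    exact hP1 _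
  have hbox : volume (unitBox ι) ≠ ⊤ := by
    rw [unitBox, volume_box]; exact ENNReal.pow_ne_top ENNReal.ofReal_ne_top
  set A := ∫ x in unitBox ι, g x with hA
  rw [integral_uniformPi hgm, ← hA]
  -- the translates of the unit cube that are used lie in a slightly larger cube
  have main : ∀ J : ℕ, J * A ≤ P * (1 + J * s) ^ Fintype.card ι := by
    intro J
    set big : Set (ι → ℝ) := Set.univ.pi fun _ => Set.Icc (-(J * s)) 1 with hbig
    have hbigm : MeasurableSet big := MeasurableSet.univ_pi fun _ => measurableSet_Icc
    have hbigv : volume big ≠ ⊤ := by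
      rw [hbig, volume_box]; exact ENNReal.pow_ne_top ENNReal.ofReal_ne_top
    have hJs : 0 ≤ J * s := by positivity
    have step : ∀ l ∈ Finset.range J,
        A ≤ ∫ x, big.indicator (fun x => g fun i => x i + l * s) x := by
      intro l hl
      have hlJ : (l : ℝ) ≤ J := by exact_mod_cast (Finset.mem_range.1 hl).le
      rw [hA, ← integral_indicator measurableSet_unitBox,
        ← integral_add_right_eq_self _ (fun _ : ι => (l * s : ℝ))]
      refine integral_mono ?_ (hint _ _ hbigm hbigv) fun x => ?_
      · have := hint 0 _ (measurableSet_unitBox (ι := ι)) hbox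
        simp only [add_zero] at this
        exact this.comp_add_right _
      · by_cases hx : x + (fun _ : ι => (l * s : ℝ)) ∈ unitBox ι
        · have hxb : x ∈ big := by
            intro i _
            have := hx i (Set.mem_univ i)
            simp only [Pi.add_apply, Set.mem_Icc] at this
            have h1 : l * s ≤ J * s := by gcongr
            have h2 : 0 ≤ l * s := by positivity
            exact ⟨by linarith, by linarith⟩
          rw [Set.indicator_of_mem hx, Set.indicator_of_mem hxb]
          rfl
        · rw [Set.indicator_of_notMem hx]
          exact Set.indicator_nonneg (fun _ _ => h0 _) _
    have hsumA : J * A ≤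
        ∑ l ∈ Finset.range J, ∫ x, big.indicator (fun x => g fun i => x i + l * s) x := by
      have := Finset.sum_le_sum step
      simpa using this
    refine hsumA.trans ?_
    rw [← integral_finsetSum _ fun l _ => hint _ _ hbigm hbigv]
    have hle : ∫ x, ∑ l ∈ Finset.range J, big.indicator (fun x => g fun i => x i + l * s) x ≤
        ∫ x, big.indicator (fun _ => P) x := by
      refine integral_mono (integrable_finsetSum _ fun l _ => hint _ _ hbigm hbigv)
        ((integrableOn_const hbigv).integrable_indicator hbigm) fun x => ?_
      by_cases hx : x ∈ big
      · simpa only [Set.indicator_of_mem hx] using hsumg J x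
      · simp [Set.indicator_of_notMem hx]
    refine hle.trans (le_of_eq ?_)
    rw [integral_indicator hbigm, setIntegral_const, measureReal_def, hbig, volume_box,
      ENNReal.toReal_pow, ENNReal.toReal_ofReal (by linarith), smul_eq_mul, mul_comm]
    ring
  have hk : (1 : ℝ) ≤ Fintype.card ι := by exact_mod_cast Fintype.card_pos
  set k := Fintype.card ι with hkdef
  have hA1 : A ≤ P := by
    have hle : A ≤ ∫ x in unitBox ι, P := by
      refine setIntegral_mono_on ?_ (integrableOn_const hbox) measurableSet_unitBox
        fun x _ => hP1 _
      have := (integrable_indicator_iff measurableSet_unitBox).1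
        (hint 0 _ (measurableSet_unitBox (ι := ι)) hbox)
      simpa only [add_zero] using this
    refine hle.trans (le_of_eq ?_)
    rw [setIntegral_const, measureReal_def, unitBox, volume_box]
    simp
  have hgoal : 6 * P * k * |τ| / |a| = 6 * (P * (k * s)) := by rw [hs]; ring
  rw [hgoal]
  rcases le_or_gt (k * s) 1 with hks | hks
  · have hkspos : 0 < k * s := by positivity
    set y := 1 / (k * s) with hy
    have hy1 : 1 ≤ y := (one_le_div hkspos).2 hks
    set J := ⌊y⌋₊ with hJ
    have hJle : (J : ℝ) ≤ y := Nat.floor_le (by linarith)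
    have hJge : y / 2 ≤ J := by
      have h1 : y < J + 1 := Nat.lt_floor_add_one y
      have h2 : (1 : ℝ) ≤ J := by exact_mod_cast Nat.one_le_floor_iff _ |>.2 hy1
      linarith
    have hpow : (1 + J * s) ^ k ≤ 3 := by
      calc (1 + J * s) ^ k ≤ Real.exp (J * s) ^ k := by
            gcongr
            linarith [Real.add_one_le_exp (J * s)]
        _ = Real.exp (J * (k * s)) := by rw [← Real.exp_nat_mul]; ring_nf
        _ ≤ Real.exp (y * (k * s)) := by gcongr
        _ = Real.exp 1 := by rw [hy, one_div, inv_mul_cancel₀ hkspos.ne']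
        _ ≤ 3 := Real.exp_one_lt_three.le
    have hA0 : 0 ≤ A := integral_nonneg fun x => h0 _
    have h1 : y / 2 * A ≤ P * 3 :=
      (mul_le_mul_of_nonneg_right hJge hA0).trans
        ((main J).trans (mul_le_mul_of_nonneg_left hpow hP))
    have h2 : A = (y / 2 * A) * (2 * (k * s)) := by
      rw [hy]; field_simp
    rw [h2]
    calc (y / 2 * A) * (2 * (k * s)) ≤ (P * 3) * (2 * (k * s)) := by gcongr
      _ = 6 * (P * (k * s)) := by ring
  · have : P * 1 ≤ P * (k * s) := mul_le_mul_of_nonneg_left hks.le hP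
    nlinarith [mul_nonneg hP (zero_le_one.trans hks.le)]

/-- Translating the uniform distribution on a cube along the diagonal changes averages of bounded
functions by at most the corresponding change in total variation. -/
theorem abs_integral_uniformPi_shift_sub_le {g : (ι → ℝ) → ℝ} (hg : Measurable g) {G : ℝ}
    (hG : ∀ x, |g x| ≤ G) {a : ℝ} (ha : a ≠ 0) (s : ℝ) (v : ι → ℝ) :
    |∫ ξ, g (fun i => v i + a * (ξ i : ℝ) + s) ∂uniformPi ι -
        ∫ ξ, g (fun i => v i + a * (ξ i : ℝ)) ∂uniformPi ι| ≤
      2 * Fintype.card ι * G * |s| / |a| := by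
  set h : (ι → ℝ) → ℝ := fun x => g (fun i => v i + a * x i) with hh
  have hhm : Measurable h := hg.comp (by fun_prop)
  have hhG : ∀ x, |h x| ≤ G := fun x => hG _
  have hG0 : 0 ≤ G := (abs_nonneg _).trans (hG 0)
  set t := s / a with ht
  set c : ι → ℝ := fun _ => t with hc
  have e1 : ∫ ξ, g (fun i => v i + a * (ξ i : ℝ) + s) ∂uniformPi ι =
      ∫ x in unitBox ι, h (x + c) := by
    have hcm : Measurable fun x => h (x + c) := hhm.comp (measurable_id.add_const c)
    rw [← integral_uniformPi hcm]
    refine integral_congr_ae (ae_of_all _ fun ξ => ?_)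
    simp only [hh, hc, ht, Pi.add_apply]
    congr 1
    funext i
    field_simp
    ring
  have e2 : ∫ ξ, g (fun i => v i + a * (ξ i : ℝ)) ∂uniformPi ι = ∫ x in unitBox ι, h x :=
    integral_uniformPi hhm
  set I : (ι → ℝ) → ℝ := (unitBox ι).indicator fun _ => 1 with hI
  have hIm : Measurable I := measurable_const.indicator measurableSet_unitBox
  have hbox : volume (unitBox ι) = 1 := by
    rw [unitBox, volume_box]; simp
  have hIint : Integrable I :=
    (integrableOn_const (by rw [hbox]; simp)).integrable_indicator measurableSet_unitBox
  have hIint' : Integrable fun x => I (x - c) := hIint.comp_sub_right c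
  have hI01 : ∀ x, I x = 0 ∨ I x = 1 := fun x => by
    by_cases hx : x ∈ unitBox ι <;> simp [hI, hx]
  have hI1 : ∫ x, I x = 1 := by
    rw [hI, integral_indicator measurableSet_unitBox]
    simp [measureReal_def, hbox]
  have hmulint : ∀ {J : (ι → ℝ) → ℝ}, Integrable J → Integrable fun x => J x * h x := by
    intro J hJ
    exact hJ.mul_bdd (c := G) hhm.aestronglyMeasurable (ae_of_all _ fun x => hhG x)
  have e2' : ∫ x in unitBox ι, h x = ∫ x, I x * h x := by
    rw [← integral_indicator measurableSet_unitBox]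
    refine integral_congr_ae (ae_of_all _ fun x => ?_)
    by_cases hx : x ∈ unitBox ι <;> simp [hI, hx]
  have e1' : ∫ x in unitBox ι, h (x + c) = ∫ x, I (x - c) * h x := by
    rw [← integral_indicator measurableSet_unitBox,
      ← integral_add_right_eq_self (fun x => I (x - c) * h x) c]
    refine integral_congr_ae (ae_of_all _ fun x => ?_)
    by_cases hx : x ∈ unitBox ι <;> simp [hI, hx]
  rw [e1, e2, e1', e2', ← integral_sub (hmulint hIint') (hmulint hIint)]
  have hprodint : Integrable fun x => I (x - c) * I x :=
    hIint'.mul_bdd (c := 1) hIm.aestronglyMeasurable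
      (ae_of_all _ fun x => by rcases hI01 x with h | h <;> simp [h])
  have hov : 1 - Fintype.card ι * |t| ≤ ∫ x, I (x - c) * I x := by
    set inter : Set (ι → ℝ) := Set.univ.pi fun _ => Set.Icc (max 0 t) (1 + min 0 t) with hinter
    have hm : MeasurableSet inter := MeasurableSet.univ_pi fun _ => measurableSet_Icc
    have hv : volume inter ≠ ⊤ := by
      rw [hinter, volume_box]; exact ENNReal.pow_ne_top ENNReal.ofReal_ne_top
    have hle : ∫ x, inter.indicator (fun _ => (1 : ℝ)) x ≤ ∫ x, I (x - c) * I x := by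
      refine integral_mono ((integrableOn_const hv).integrable_indicator hm) hprodint fun x => ?_
      by_cases hx : x ∈ inter
      · have hx1 : x ∈ unitBox ι := fun i _ => by
          have := hx i (Set.mem_univ i)
          exact ⟨(le_max_left _ _).trans this.1, this.2.trans (by linarith [min_le_left 0 t])⟩
        have hx2 : x - c ∈ unitBox ι := fun i _ => by
          have := hx i (Set.mem_univ i)
          simp only [Pi.sub_apply, hc, Set.mem_Icc] at this ⊢
          exact ⟨by linarith [le_max_right 0 t], by linarith [min_le_right 0 t]⟩
        simp [hI, hx, hx1, hx2]
      · rw [Set.indicator_of_notMem hx]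
        rcases hI01 x with h | h <;> rcases hI01 (x - c) with h' | h' <;> simp [h, h']
    refine le_trans ?_ hle
    rw [integral_indicator hm, setIntegral_const, measureReal_def, hinter, volume_box,
      ENNReal.toReal_pow, ENNReal.toReal_ofReal', smul_eq_mul, mul_one]
    have hlen : 1 + min 0 t - max 0 t = 1 - |t| := by
      rcases le_total 0 t with h | h
      · rw [min_eq_left h, max_eq_right h, abs_of_nonneg h]; ring
      · rw [min_eq_right h, max_eq_left h, abs_of_nonpos h]; ring
    rw [hlen]
    rcases le_or_gt |t| 1 with h1 | h1
    · rw [max_eq_left (by linarith)]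
      have := one_add_mul_le_pow (a := -|t|) (by linarith) (Fintype.card ι)
      calc 1 - Fintype.card ι * |t| = 1 + Fintype.card ι * -|t| := by ring
        _ ≤ _ := this
        _ = _ := by ring
    · rcases Nat.eq_zero_or_pos (Fintype.card ι) with h0 | h0
      · simp [h0]
      · have : (1 : ℝ) ≤ Fintype.card ι := by exact_mod_cast h0
        have h3 : 1 - Fintype.card ι * |t| ≤ 0 := by nlinarith
        exact h3.trans (pow_nonneg (le_max_right _ _) _)
  calc |∫ x, (I (x - c) * h x - I x * h x)|
      ≤ ∫ x, |I (x - c) * h x - I x * h x| := abs_integral_le_integral_abs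
    _ ≤ ∫ x, G * (I (x - c) + I x - 2 * (I (x - c) * I x)) := by
        refine integral_mono ((hmulint hIint').sub (hmulint hIint)).abs
          (((hIint'.add hIint).sub (hprodint.const_mul 2)).const_mul G) fun x => ?_
        simp only
        rw [← sub_mul, abs_mul, mul_comm]
        refine mul_le_mul (hhG x) ?_ (abs_nonneg _) hG0
        rcases hI01 x with h | h <;> rcases hI01 (x - c) with h' | h' <;> norm_num [h, h']
    _ = G * (2 - 2 * ∫ x, I (x - c) * I x) := by
        have hsum : Integrable fun x => I (x - c) + I x := hIint'.add hIint
        rw [integral_const_mul, integral_sub hsum (hprodint.const_mul 2),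
          integral_add hIint' hIint, integral_const_mul, integral_sub_right_eq_self I c, hI1]
        norm_num
    _ ≤ G * (2 * (Fintype.card ι * |t|)) := by gcongr; linarith
    _ = 2 * Fintype.card ι * G * |s| / |a| := by rw [ht, abs_div]; ring

end CubeAverages

/-! ### Resampling finitely many coordinates -/

section Resampling

variable {ι I : Type*} [Fintype ι]

theorem measurable_extend_uncurry (e : ι → I) : Measurable
    fun p : (ι → unitInterval) × (I → unitInterval) => Function.extend e p.1 p.2 := by
  classical
  refine measurable_pi_iff.2 fun i => ?_
  by_cases h : ∃ x, e x = i
  · have : (fun p : (ι → unitInterval) × (I → unitInterval) => Function.extend e p.1 p.2 i) =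
        fun p => p.1 (Classical.choose h) := funext fun p => by rw [Function.extend_def, dif_pos h]
    rw [this]
    fun_prop
  · have : (fun p : (ι → unitInterval) × (I → unitInterval) => Function.extend e p.1 p.2 i) =
        fun p => p.2 i := funext fun p => by rw [Function.extend_def, dif_neg h]
    rw [this]
    fun_prop

/-- Replacing finitely many of the independent coordinates by fresh ones preserves the product
measure. -/
theorem measurePreserving_extend {e : ι → I} (he : Function.Injective e) : MeasurePreserving
    (fun p : (ι → unitInterval) × (I → unitInterval) => Function.extend e p.1 p.2)
    ((uniformPi ι).prod (Measure.infinitePi fun _ => (volume : Measure unitInterval)))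
    (Measure.infinitePi fun _ => (volume : Measure unitInterval)) := by
  classical
  refine ⟨measurable_extend_uncurry e, Measure.eq_infinitePi _ fun s t ht => ?_⟩
  rw [Measure.map_apply (measurable_extend_uncurry e)
    (MeasurableSet.pi s.countable_toSet fun i _ => ht i)]
  set s₁ := s.filter fun i => ∃ x, e x = i with hs₁
  set s₂ := s.filter fun i => ¬ ∃ x, e x = i with hs₂
  have hpre : (fun p : (ι → unitInterval) × (I → unitInterval) => Function.extend e p.1 p.2) ⁻¹'
      (Set.pi s t) =
      (Set.univ.pi fun x => if e x ∈ s then t (e x) else Set.univ) ×ˢ (Set.pi s₂ t) := by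
    ext ⟨ξ, θ⟩
    simp only [Set.mem_preimage, Set.mem_pi, Set.mem_prod, Finset.mem_coe, Set.mem_univ,
      forall_true_left, hs₂, Finset.mem_filter]
    constructor
    · intro h
      refine ⟨fun x => ?_, fun i hi => ?_⟩
      · split_ifs with hx
        · have := h _ hx
          rwa [he.extend_apply] at this
        · trivial
      · have := h i hi.1
        rwa [Function.extend_apply' _ _ _ hi.2] at this
    · rintro ⟨h1, h2⟩ i hi
      by_cases hx : ∃ x, e x = i
      · obtain ⟨x, rfl⟩ := hx
        have := h1 x
        rw [if_pos hi] at this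
        rwa [he.extend_apply]
      · rw [Function.extend_apply' _ _ _ hx]
        exact h2 i ⟨hi, hx⟩
  rw [hpre, Measure.prod_prod, Measure.pi_pi, Measure.infinitePi_pi _ fun i _ => ht i,
    ← Finset.prod_filter_mul_prod_filter_not s fun i => ∃ x, e x = i]
  congr 1
  have hs₁' : s₁ = (Finset.univ.filter fun x => e x ∈ s).image e := by
    ext i
    simp only [hs₁, Finset.mem_filter, Finset.mem_image, Finset.mem_univ, true_and]
    constructor
    · rintro ⟨hi, x, rfl⟩
      exact ⟨x, hi, rfl⟩
    · rintro ⟨x, hx, rfl⟩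
      exact ⟨hx, x, rfl⟩
  rw [← hs₁, hs₁', Finset.prod_image he.injOn, Finset.prod_filter]
  refine Finset.prod_congr rfl fun x _ => ?_
  split_ifs <;> simp

theorem integral_resample {e : ι → I} (he : Function.Injective e) {F : (I → unitInterval) → ℝ}
    (hF : Measurable F) {C : ℝ} (hC : ∀ θ, |F θ| ≤ C) :
    ∫ θ, F θ ∂(Measure.infinitePi fun _ => (volume : Measure unitInterval)) =
      ∫ θ, ∫ ξ, F (Function.extend e ξ θ) ∂uniformPi ι
        ∂(Measure.infinitePi fun _ => (volume : Measure unitInterval)) := by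
  have h := measurePreserving_extend he
  rw [← h.map_eq, integral_map h.measurable.aemeasurable hF.aestronglyMeasurable, h.map_eq]
  refine integral_prod_symm _ ?_
  exact Integrable.of_bound (hF.comp h.measurable).aestronglyMeasurable C
    (ae_of_all _ fun p => hC _)

end Resampling

/-! ### Dyadic cells and the randelette potential -/

section Potential

variable {ν d : ℕ}

/-- The representative of a point of the circle in `[0,1)`. -/
noncomputable def circleRep (x : UnitAddCircle) : ℝ := (AddCircle.equivIco 1 0 x : ℝ)

theorem circleRep_mem (x : UnitAddCircle) : circleRep x ∈ Set.Ico (0 : ℝ) 1 := by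
  simpa [circleRep] using (AddCircle.equivIco 1 0 x).2

theorem coe_circleRep (x : UnitAddCircle) : ((circleRep x : ℝ) : UnitAddCircle) = x :=
  AddCircle.coe_equivIco

theorem circleRep_coe {t : ℝ} (ht : t ∈ Set.Ico (0 : ℝ) 1) :
    circleRep (t : UnitAddCircle) = t :=
  AddCircle.equivIco_coe_of_mem (by simpa using ht)

theorem measurable_circleRep : Measurable circleRep :=
  measurable_subtype_coe.comp (AddCircle.measurableEquivIco (T := 1) 0).measurable

/-- The index of the level-`n` dyadic cube that contains `ω`. -/
noncomputable def cellIndex (n : ℕ+) (ω : UnitAddTorus (Fin ν)) : Fin ν → Fin (2 ^ (n : ℕ)) :=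
  fun j => ⟨⌊2 ^ (n : ℕ) * circleRep (ω j)⌋₊, by
    have h := circleRep_mem (ω j)
    have h2 : (0 : ℝ) < 2 ^ (n : ℕ) := by positivity
    rw [Nat.floor_lt (mul_nonneg h2.le h.1)]
    push_cast
    nlinarith [h.2]⟩

theorem mem_dyadicCube_iff {n : ℕ+} {k : Fin ν → Fin (2 ^ (n : ℕ))} {ω : UnitAddTorus (Fin ν)} :
    ω ∈ dyadicCube n k ↔ cellIndex n ω = k := by
  have h2 : (0 : ℝ) < 2 ^ (n : ℕ) := by positivity
  rw [funext_iff]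
  refine forall_congr' fun j => ?_
  have hfl : cellIndex n ω j = k j ↔
      ((k j : ℕ) : ℝ) ≤ 2 ^ (n : ℕ) * circleRep (ω j) ∧
        2 ^ (n : ℕ) * circleRep (ω j) < ((k j : ℕ) : ℝ) + 1 := by
    rw [Fin.ext_iff]
    exact Nat.floor_eq_iff (mul_nonneg h2.le (circleRep_mem _).1)
  rw [hfl]
  constructor
  · rintro ⟨t, ⟨h3, h4⟩, ht⟩
    have hk : ((k j : ℕ) : ℝ) + 1 ≤ 2 ^ (n : ℕ) := by exact_mod_cast (k j).2
    have ht01 : t ∈ Set.Ico (0 : ℝ) 1 :=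
      ⟨le_trans (by positivity) h3, h4.trans_le ((div_le_one h2).2 hk)⟩
    rw [← ht]
    simp only
    rw [circleRep_coe ht01]
    rw [div_le_iff₀ h2] at h3
    rw [lt_div_iff₀ h2] at h4
    constructor <;> linarith
  · rintro ⟨h3, h4⟩
    refine ⟨circleRep (ω j), ⟨?_, ?_⟩, coe_circleRep _⟩
    · rw [div_le_iff₀ h2]; linarith
    · rw [lt_div_iff₀ h2]; linarith

theorem measurable_cellIndex (n : ℕ+) : Measurable (cellIndex (ν := ν) n) := by
  refine measurable_pi_iff.2 fun j => ?_
  have h : Measurable fun ω : UnitAddTorus (Fin ν) => 2 ^ (n : ℕ) * circleRep (ω j) :=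
    (measurable_circleRep.comp (measurable_pi_apply j)).const_mul _
  refine measurable_to_countable' fun k => ?_
  have : (fun ω : UnitAddTorus (Fin ν) => cellIndex n ω j) ⁻¹' {k} =
      (fun ω => ⌊2 ^ (n : ℕ) * circleRep (ω j)⌋₊) ⁻¹' {(k : ℕ)} := by
    ext ω
    simp [Fin.ext_iff, cellIndex]
  rw [this]
  exact (Nat.measurable_floor.comp h) (measurableSet_singleton _)

theorem dist_lt_of_cellIndex_eq {n : ℕ+} {ω ω' : UnitAddTorus (Fin ν)}
    (h : cellIndex n ω = cellIndex n ω') : dist ω ω' < (1 / 2) ^ (n : ℕ) := by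
  have h2 : (0 : ℝ) < 2 ^ (n : ℕ) := by positivity
  refine (dist_pi_lt_iff (by positivity)).2 fun j => ?_
  have hj : ⌊2 ^ (n : ℕ) * circleRep (ω j)⌋₊ = ⌊2 ^ (n : ℕ) * circleRep (ω' j)⌋₊ :=
    congrArg Fin.val (congrFun h j)
  have b1 := Nat.floor_le (mul_nonneg h2.le (circleRep_mem (ω j)).1)
  have b2 := Nat.lt_floor_add_one (2 ^ (n : ℕ) * circleRep (ω j))
  have b3 := Nat.floor_le (mul_nonneg h2.le (circleRep_mem (ω' j)).1)
  have b4 := Nat.lt_floor_add_one (2 ^ (n : ℕ) * circleRep (ω' j))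
  rw [hj] at b1 b2
  have habs : |circleRep (ω j) - circleRep (ω' j)| < (1 / 2) ^ (n : ℕ) := by
    rw [one_div, inv_pow, ← one_div, abs_lt, ← neg_div, div_lt_iff₀ h2, lt_div_iff₀ h2]
    constructor <;> linarith
  refine lt_of_le_of_lt ?_ habs
  rw [← coe_circleRep (ω j), ← coe_circleRep (ω' j), dist_eq_norm, ← AddCircle.coe_sub]
  simp only [coe_circleRep]
  rw [UnitAddCircle.norm_eq]
  simpa using round_le (circleRep (ω j) - circleRep (ω' j)) 0

variable {a : ℕ+ → ℝ}

theorem randelette_eq_tsum (a : ℕ+ → ℝ) (ω : UnitAddTorus (Fin ν)) (θ : Param ν) :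
    randelette a ω θ = ∑' n : ℕ+, a n * (θ ⟨n, cellIndex n ω⟩ : ℝ) := by
  classical
  unfold randelette
  refine tsum_congr fun n => ?_
  rw [Finset.sum_eq_single (cellIndex n ω)]
  · rw [Set.indicator_of_mem (mem_dyadicCube_iff.2 rfl), mul_one]
  · intro k _ hk
    rw [Set.indicator_of_notMem (fun h => hk (mem_dyadicCube_iff.1 h).symm), mul_zero]
  · simp

theorem summable_randelette (ha : Summable fun n => |a n|) (ω : UnitAddTorus (Fin ν))
    (θ : Param ν) : Summable fun n : ℕ+ => a n * (θ ⟨n, cellIndex n ω⟩ : ℝ) := by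
  refine Summable.of_norm_bounded ha fun n => ?_
  have h := (θ ⟨n, cellIndex n ω⟩).2
  rw [norm_mul, Real.norm_eq_abs, Real.norm_eq_abs, abs_of_nonneg h.1]
  exact mul_le_of_le_one_right (abs_nonneg _) h.2

theorem measurable_randelette (ha : Summable fun n => |a n|) :
    Measurable fun p : UnitAddTorus (Fin ν) × Param ν => randelette a p.1 p.2 := by
  have hterm : ∀ n : ℕ+, Measurable fun p : UnitAddTorus (Fin ν) × Param ν =>
      a n * (p.2 ⟨n, cellIndex n p.1⟩ : ℝ) := by
    intro n
    refine Measurable.const_mul ?_ _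
    have h : Measurable fun q : (Fin ν → Fin (2 ^ (n : ℕ))) × Param ν => (q.2 ⟨n, q.1⟩ : ℝ) :=
      measurable_from_prod_countable_right fun k => by
        have hk : Measurable fun θ : Param ν => (θ ⟨n, k⟩ : ℝ) :=
          measurable_subtype_coe.comp (measurable_pi_apply _)
        exact hk
    exact h.comp (((measurable_cellIndex n).comp measurable_fst).prodMk measurable_snd)
  refine measurable_of_tendsto_metrizable' (Filter.atTop : Filter (Finset ℕ+))
    (f := fun s p => ∑ n ∈ s, a n * (p.2 ⟨n, cellIndex n p.1⟩ : ℝ))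
    (fun s => Finset.measurable_sum _ fun n _ => hterm n) ?_
  refine tendsto_pi_nhds.2 fun p => ?_
  rw [randelette_eq_tsum]
  exact (summable_randelette ha p.1 p.2).hasSum

/-- If two parameters differ, along the cells of `ω`, only at level `n`, then the values of the
potential differ by the contribution of that level. -/
theorem randelette_eq_add (ha : Summable fun n => |a n|) {ω : UnitAddTorus (Fin ν)}
    {θ θ' : Param ν} (n : ℕ+)
    (h : ∀ m, m ≠ n → θ ⟨m, cellIndex m ω⟩ = θ' ⟨m, cellIndex m ω⟩) :
    randelette a ω θ = randelette a ω θ' +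
      a n * ((θ ⟨n, cellIndex n ω⟩ : ℝ) - θ' ⟨n, cellIndex n ω⟩) := by
  have key : randelette a ω θ - randelette a ω θ' =
      a n * ((θ ⟨n, cellIndex n ω⟩ : ℝ) - θ' ⟨n, cellIndex n ω⟩) := by
    rw [randelette_eq_tsum, randelette_eq_tsum,
      ← (summable_randelette ha ω θ).tsum_sub (summable_randelette ha ω θ'),
      tsum_eq_single n]
    · ring
    · intro m hm
      rw [h m hm, sub_self]
  linarith

variable {T : Lattice d → UnitAddTorus (Fin ν) → UnitAddTorus (Fin ν)}

/-- The indices of the level-`n` cells visited by the part of the orbit of `ω` indexed by `Q`. -/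
noncomputable def orbitCells (T : Lattice d → UnitAddTorus (Fin ν) → UnitAddTorus (Fin ν))
    (Q : Finset (Lattice d)) (n : ℕ+) (ω : UnitAddTorus (Fin ν)) (x : Q) :
    Σ n : ℕ+, (Fin ν → Fin (2 ^ (n : ℕ))) :=
  ⟨n, cellIndex n (T x ω)⟩

/-- The function on the lattice that agrees with `w` on `Q` and vanishes elsewhere. -/
noncomputable def spread (Q : Finset (Lattice d)) (w : Q → ℝ) (x : Lattice d) : ℝ :=
  if h : x ∈ Q then w ⟨x, h⟩ else 0

theorem measurable_potential (ha : Summable fun n => |a n|) (hT : ∀ x, Measurable (T x)) :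
    Measurable fun p : UnitAddTorus (Fin ν) × Param ν => potential a T p.1 p.2 := by
  refine measurable_pi_iff.2 fun x => ?_
  exact (measurable_randelette ha).comp (((hT x).comp measurable_fst).prodMk measurable_snd)

/-- Resampling the cells of level `n` visited by the orbit of `ω` over `Q` adds independent terms
to the values of the potential on `Q` and does not change the values at other sites. -/
theorem potential_extend (ha : Summable fun n => |a n|) {Q S : Finset (Lattice d)} {n : ℕ+}
    {ω : UnitAddTorus (Fin ν)}
    (hinj : ∀ x ∈ Q, ∀ y ∈ S, x ≠ y → cellIndex n (T x ω) ≠ cellIndex n (T y ω))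
    (hQS : Q ⊆ S) (ξ : Q → unitInterval) (θ : Param ν) {y : Lattice d} (hy : y ∈ S) :
    potential a T ω (Function.extend (orbitCells T Q n ω) ξ θ) y =
      potential a T ω (Function.extend (orbitCells T Q n ω) (fun _ => 0) θ) y +
        spread Q (fun x => a n * (ξ x : ℝ)) y := by
  have hinj' : Function.Injective (orbitCells T Q n ω) := by
    intro x y hxy
    by_contra hne
    refine hinj x x.2 y (hQS y.2) (fun h => hne (Subtype.ext h)) ?_
    simpa [orbitCells] using hxy
  have hlev : ∀ m, m ≠ n → ∀ k, ¬ ∃ x, orbitCells T Q n ω x = ⟨m, k⟩ := by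
    rintro m hm k ⟨x, hx⟩
    exact hm (congrArg Sigma.fst hx).symm
  unfold potential
  rw [randelette_eq_add ha n (θ' := Function.extend (orbitCells T Q n ω) (fun _ => 0) θ)
    fun m hm => by
      rw [Function.extend_apply' _ _ _ (hlev m hm _), Function.extend_apply' _ _ _ (hlev m hm _)]]
  congr 1
  unfold spread
  split_ifs with h
  · have hy' : (⟨n, cellIndex n (T y ω)⟩ : Σ n : ℕ+, (Fin ν → Fin (2 ^ (n : ℕ)))) =
        orbitCells T Q n ω ⟨y, h⟩ := rfl
    rw [hy', hinj'.extend_apply, hinj'.extend_apply]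
    simp
  · have hno : ¬ ∃ x, orbitCells T Q n ω x = ⟨n, cellIndex n (T y ω)⟩ := by
      rintro ⟨x, hx⟩
      refine hinj x x.2 y hy (fun hxy => h (hxy ▸ x.2)) ?_
      simpa [orbitCells] using hx
    rw [Function.extend_apply' _ _ _ hno, Function.extend_apply' _ _ _ hno]
    simp

/-- Resampling cells visited by the orbit of `ω` does not affect the potential along the orbit of
`ω'` if the two orbits visit different cells. -/
theorem potential_extend_of_ne {Q S : Finset (Lattice d)} {n : ℕ+}
    {ω ω' : UnitAddTorus (Fin ν)}
    (hne : ∀ x ∈ Q, ∀ y ∈ S, cellIndex n (T x ω) ≠ cellIndex n (T y ω'))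
    (ξ : Q → unitInterval) (θ : Param ν) {y : Lattice d} (hy : y ∈ S) :
    potential a T ω' (Function.extend (orbitCells T Q n ω) ξ θ) y = potential a T ω' θ y := by
  unfold potential
  rw [randelette_eq_tsum, randelette_eq_tsum]
  refine tsum_congr fun m => ?_
  rw [Function.extend_apply']
  rintro ⟨x, hx⟩
  obtain rfl : n = m := congrArg Sigma.fst hx
  refine hne x x.2 y hy ?_
  simpa [orbitCells] using hx

theorem injective_orbitCells {Q : Finset (Lattice d)} {n : ℕ+} {ω : UnitAddTorus (Fin ν)}
    (hinj : ∀ x ∈ Q, ∀ y ∈ Q, x ≠ y → cellIndex n (T x ω) ≠ cellIndex n (T y ω)) :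
    Function.Injective (orbitCells T Q n ω) := by
  intro x y hxy
  by_contra hne
  refine hinj x x.2 y y.2 (fun h => hne (Subtype.ext h)) ?_
  simpa [orbitCells] using hxy

instance isProbabilityMeasure_torus :
    IsProbabilityMeasure (volume : Measure (UnitAddTorus (Fin ν))) := by
  constructor
  rw [volume_pi, Measure.pi_univ]
  simp [AddCircle.measure_univ]

theorem volume_closedBall_torus_le (hν : 1 ≤ ν) (ω : UnitAddTorus (Fin ν)) {s : ℝ} (hs : 0 ≤ s) :
    volume (Metric.closedBall ω s) ≤ ENNReal.ofReal (2 * s) := by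
  rw [volume_pi_closedBall _ hs]
  have h1 : ∀ j, volume (Metric.closedBall (ω j) s) ≤ 1 := fun j => by
    rw [AddCircle.volume_closedBall, ← ENNReal.ofReal_one]
    exact ENNReal.ofReal_le_ofReal (min_le_left _ _)
  calc ∏ j, volume (Metric.closedBall (ω j) s)
      ≤ volume (Metric.closedBall (ω ⟨0, hν⟩) s) := by
        rw [← Finset.mul_prod_erase _ _ (Finset.mem_univ (⟨0, hν⟩ : Fin ν))]
        exact mul_le_of_le_one_right' (Finset.prod_le_one' fun j _ => h1 j)
    _ ≤ ENNReal.ofReal (2 * s) := by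
        rw [AddCircle.volume_closedBall]
        exact ENNReal.ofReal_le_ofReal (min_le_right _ _)

/-- The set of pairs of points of the torus whose orbits come within distance `s` of each other
inside the finite set `S`. -/
def closePairs (T : Lattice d → UnitAddTorus (Fin ν) → UnitAddTorus (Fin ν))
    (S : Finset (Lattice d)) (s : ℝ) : Set (UnitAddTorus (Fin ν) × UnitAddTorus (Fin ν)) :=
  {p | ∃ x ∈ S, ∃ y ∈ S, dist (T x p.1) (T y p.2) < s}

theorem closePairs_eq (S : Finset (Lattice d)) (s : ℝ) : closePairs T S s =
    ⋃ x ∈ S, ⋃ y ∈ S, {p | dist (T x p.1) (T y p.2) < s} := by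
  ext p
  simp [closePairs]

theorem measurableSet_closePairs (hT : ∀ x, Measurable (T x)) (S : Finset (Lattice d)) (s : ℝ) :
    MeasurableSet (closePairs T S s) := by
  rw [closePairs_eq]
  refine Finset.measurableSet_biUnion _ fun x _ => Finset.measurableSet_biUnion _ fun y _ => ?_
  exact measurableSet_lt (((hT x).comp measurable_fst).dist ((hT y).comp measurable_snd))
    measurable_const

theorem volume_closePairs_le (hν : 1 ≤ ν) (hT : ∀ x, MeasurePreserving (T x) volume volume)
    (S : Finset (Lattice d)) {s : ℝ} (hs : 0 ≤ s) :
    (volume.prod volume).real (closePairs T S s) ≤ S.card ^ 2 * (2 * s) := by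
  have hpair : ∀ x y, (volume.prod volume)
      {p : UnitAddTorus (Fin ν) × UnitAddTorus (Fin ν) | dist (T x p.1) (T y p.2) < s} ≤
      ENNReal.ofReal (2 * s) := by
    intro x y
    have hm : MeasurableSet {p : UnitAddTorus (Fin ν) × UnitAddTorus (Fin ν) |
        dist (T x p.1) (T y p.2) < s} :=
      measurableSet_lt (((hT x).measurable.comp measurable_fst).dist
        ((hT y).measurable.comp measurable_snd)) measurable_const
    rw [Measure.prod_apply hm]
    calc _ ≤ ∫⁻ _ω : UnitAddTorus (Fin ν), ENNReal.ofReal (2 * s) := by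
          refine lintegral_mono fun ω => ?_
          have hsub : Prod.mk ω ⁻¹' {p : UnitAddTorus (Fin ν) × UnitAddTorus (Fin ν) |
              dist (T x p.1) (T y p.2) < s} ⊆ T y ⁻¹' Metric.closedBall (T x ω) s := by
            intro ω' h
            simp only [Set.mem_preimage, Set.mem_ofPred_eq] at h
            rw [Set.mem_preimage, Metric.mem_closedBall, dist_comm]
            exact h.le
          refine (measure_mono hsub).trans ?_
          rw [(hT y).measure_preimage measurableSet_closedBall.nullMeasurableSet]
          exact volume_closedBall_torus_le hν _ hs
      _ = _ := by simp
  have hbound : (volume.prod volume) (closePairs T S s) ≤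
      ENNReal.ofReal (S.card ^ 2 * (2 * s)) := by
    rw [closePairs_eq]
    calc _ ≤ ∑ x ∈ S, ∑ y ∈ S, ENNReal.ofReal (2 * s) :=
          (measure_biUnion_finset_le _ _).trans (Finset.sum_le_sum fun x _ =>
            (measure_biUnion_finset_le _ _).trans (Finset.sum_le_sum fun y _ => hpair x y))
      _ = _ := by
          rw [Finset.sum_const, Finset.sum_const, nsmul_eq_mul, nsmul_eq_mul,
            ENNReal.ofReal_mul (p := (S.card : ℝ) ^ 2) (by positivity),
            ENNReal.ofReal_pow (by positivity), ENNReal.ofReal_natCast, sq, mul_assoc]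
  exact ENNReal.toReal_le_of_le_ofReal (by positivity) hbound

end Potential

/-! ### Counting functionals that are translated by shifts of the potential -/

section ShiftCount

variable {d : ℕ}

/-- A family of functionals `F α β` of the potential that behave as the number of points, between
`α` and `β`, of a set of at most `P` reals which depends only on the potential on `S` and is
translated, by a multiple `m` of `t` with `1 ≤ |m|`, when `t` is added to the potential on `Q`. -/
structure IsShiftCount (S Q : Finset (Lattice d)) (P : ℝ) (F : ℝ → ℝ → (Lattice d → ℝ) → ℝ) :
    Prop where
  nonneg : ∀ {α β : ℝ}, α ≤ β → ∀ V, 0 ≤ F α β V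
  le : ∀ α β V, F α β V ≤ P
  add : ∀ α β γ V, F α β V + F β γ V = F α γ V
  measurable : ∀ {α β : ℝ}, α ≤ β → Measurable (F α β)
  congr : ∀ {α β V V'}, (∀ x ∈ S, V x = V' x) → F α β V = F α β V'
  shift : ∃ m : ℝ, 1 ≤ |m| ∧ ∀ α β t V,
    F α β (fun x => V x + if x ∈ Q then t else 0) = F (α - m * t) (β - m * t) V
  nonempty : Q.Nonempty
  subset : Q ⊆ S

/-- The increment between the scales `2 * h` and `h` of the normalized number of points in a
neighbourhood of zero. -/
noncomputable def scaleIncrement (F : ℝ → ℝ → (Lattice d → ℝ) → ℝ) (h : ℝ) (V : Lattice d → ℝ) : ℝ :=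
  F (-(2 * h)) (2 * h) V / (2 * (2 * h)) - F (-h) h V / (2 * h)

theorem measurable_spread_apply {X : Type*} [MeasurableSpace X] {Q : Finset (Lattice d)}
    {f : X → Q → ℝ} (hf : ∀ i, Measurable fun p => f p i) (x : Lattice d) :
    Measurable fun p => spread Q (f p) x := by
  unfold spread
  split_ifs with h
  · exact hf _
  · exact measurable_const

theorem spread_add (Q : Finset (Lattice d)) (w w' : Q → ℝ) (x : Lattice d) :
    spread Q (fun i => w i + w' i) x = spread Q w x + spread Q w' x := by
  unfold spread
  split_ifs <;> simp

theorem spread_const (Q : Finset (Lattice d)) (t : ℝ) (x : Lattice d) :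
    spread Q (fun _ => t) x = if x ∈ Q then t else 0 := by
  unfold spread
  split_ifs <;> rfl

namespace IsShiftCount

variable {S Q : Finset (Lattice d)} {P : ℝ} {F : ℝ → ℝ → (Lattice d → ℝ) → ℝ}

theorem self_eq_zero (hF : IsShiftCount S Q P F) (α : ℝ) (V : Lattice d → ℝ) : F α α V = 0 := by
  have := hF.add α α α V
  linarith

theorem bound_nonneg (hF : IsShiftCount S Q P F) : 0 ≤ P :=
  (hF.nonneg (le_refl 0) 0).trans (hF.le 0 0 0)

theorem abs_le (hF : IsShiftCount S Q P F) {α β : ℝ} (h : α ≤ β) (V : Lattice d → ℝ) :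
    |F α β V| ≤ P := by
  rw [abs_of_nonneg (hF.nonneg h V)]
  exact hF.le _ _ _

theorem sum_adjacent (hF : IsShiftCount S Q P F) (e h : ℝ) (V : Lattice d → ℝ) (J : ℕ) :
    ∑ l ∈ Finset.range J, F (e - 2 * h * (l + 1)) (e - 2 * h * l) V = F (e - 2 * h * J) e V := by
  induction J with
  | zero => simp [hF.self_eq_zero]
  | succ k ih =>
    rw [Finset.sum_range_succ, ih, add_comm, hF.add]
    push_cast
    rfl

theorem spread_shift (hF : IsShiftCount S Q P F) {m : ℝ}
    (hm : ∀ α β t V,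
      F α β (fun x => V x + if x ∈ Q then t else 0) = F (α - m * t) (β - m * t) V)
    (α β t : ℝ) (V : Lattice d → ℝ) (w : Q → ℝ) :
    F α β (fun x => V x + spread Q (fun i => w i + t) x) =
      F (α - m * t) (β - m * t) (fun x => V x + spread Q w x) := by
  rw [← hm]
  refine hF.congr fun x _ => ?_
  rw [spread_add, spread_const]
  ring

/-- The Wegner estimate: the expected number of points in an interval of length `2 * h` when
independent uniform variables with amplitude `a` are added to the potential on `Q`. -/
theorem integral_le (hF : IsShiftCount S Q P F) {h a : ℝ} (hh : 0 < h) (ha : a ≠ 0)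
    (V : Lattice d → ℝ) :
    ∫ ξ, F (-h) h (fun x => V x + spread Q (fun i => a * (ξ i : ℝ)) x) ∂uniformPi Q ≤
      12 * P * Q.card * h / |a| := by
  obtain ⟨m, hm1, hm⟩ := hF.shift
  have hm0 : m ≠ 0 := fun h0 => by norm_num [h0] at hm1
  have : Nonempty Q := hF.nonempty.to_subtype
  have hV : Measurable fun w : Q → ℝ => fun x => V x + spread Q w x :=
    measurable_pi_iff.2 fun x => (measurable_spread_apply (fun i => measurable_pi_apply i) x).const_add _
  have key := integral_uniformPi_le_of_sum_shift_le (ι := Q)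
    (f := fun w => F (-h) h (fun x => V x + spread Q w x)) (P := P) (τ := 2 * h / m) (a := a)
    ((hF.measurable (by linarith)).comp hV) (fun w => hF.nonneg (by linarith) _)
    (div_ne_zero (by positivity) hm0) ha (fun J w => ?_) 0
  · simp only [Pi.zero_apply, zero_add, Fintype.card_coe] at key
    refine key.trans ?_
    have hP := hF.bound_nonneg
    have : |2 * h / m| ≤ 2 * h := by
      rw [abs_div, abs_of_pos (by positivity : 0 < 2 * h)]
      exact div_le_self (by positivity) hm1
    calc 6 * P * Q.card * |2 * h / m| / |a| ≤ 6 * P * Q.card * (2 * h) / |a| := by gcongr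
      _ = _ := by ring
  · refine le_trans (le_of_eq ?_) (hF.le (h - 2 * h * J) h fun x => V x + spread Q w x)
    rw [← hF.sum_adjacent]
    refine Finset.sum_congr rfl fun l _ => ?_
    rw [hF.spread_shift hm]
    have : m * (l * (2 * h / m)) = 2 * h * l := by field_simp
    rw [this]
    congr 1
    ring

/-- When two independent layers of uniform variables are added, the expected number of points in an
interval is a Lipschitz function of its position. -/
theorem abs_integral_translate_sub_le (hF : IsShiftCount S Q P F) {h a b : ℝ} (hh : 0 < h)
    (ha : a ≠ 0) (hb : b ≠ 0) (c : ℝ) (V : Lattice d → ℝ) :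
    |∫ ξ, ∫ η, F (c - h) (c + h) (fun x => V x + spread Q (fun i => a * (ξ i : ℝ)) x +
          spread Q (fun i => b * (η i : ℝ)) x) ∂uniformPi Q ∂uniformPi Q -
        ∫ ξ, ∫ η, F (-h) h (fun x => V x + spread Q (fun i => a * (ξ i : ℝ)) x +
          spread Q (fun i => b * (η i : ℝ)) x) ∂uniformPi Q ∂uniformPi Q| ≤
      24 * P * Q.card ^ 2 * h * |c| / (|a| * |b|) := by
  obtain ⟨m, hm1, hm⟩ := hF.shift
  have hm0 : m ≠ 0 := fun h0 => by norm_num [h0] at hm1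
  have hP := hF.bound_nonneg
  set g : (Q → ℝ) → ℝ := fun w =>
    ∫ η, F (-h) h (fun x => V x + spread Q w x + spread Q (fun i => b * (η i : ℝ)) x)
      ∂uniformPi Q with hg
  have hgm : Measurable g := by
    have hin : Measurable fun q : (Q → ℝ) × (Q → unitInterval) =>
        fun x => V x + spread Q q.1 x + spread Q (fun i => b * (q.2 i : ℝ)) x := by
      refine measurable_pi_iff.2 fun x => Measurable.add ?_ ?_
      · exact (measurable_spread_apply (fun i => by fun_prop) x).const_add _
      · exact measurable_spread_apply (fun i => by fun_prop) x
    have hFm := ((hF.measurable (by linarith : -h ≤ h)).comp hin).stronglyMeasurable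
    exact (hFm.integral_prod_right' (ν := uniformPi Q)).measurable
  have hgb : ∀ w, |g w| ≤ 12 * P * Q.card * h / |b| := fun w => by
    rw [abs_of_nonneg (integral_nonneg fun η => hF.nonneg (by linarith) _)]
    exact hF.integral_le hh hb _
  have key := abs_integral_uniformPi_shift_sub_le hgm hgb ha (-(c / m)) 0
  have hshift : ∀ w, g (fun i => w i + -(c / m)) =
      ∫ η, F (c - h) (c + h) (fun x => V x + spread Q w x + spread Q (fun i => b * (η i : ℝ)) x)
        ∂uniformPi Q := by
    intro w
    simp only [hg]
    refine integral_congr_ae (ae_of_all _ fun η => ?_)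
    have h1 := hF.spread_shift hm (-h) h (-(c / m))
      (fun x => V x + spread Q (fun i => b * (η i : ℝ)) x) w
    have h2 : m * -(c / m) = -c := by field_simp
    rw [h2] at h1
    have e1 : -h - -c = c - h := by ring
    have e2 : h - -c = c + h := by ring
    rw [e1, e2] at h1
    simp only [add_right_comm (V _) (spread Q (fun i => w i + -(c / m)) _),
      add_right_comm (V _) (spread Q w _)]
    exact h1
  simp only [Pi.zero_apply, zero_add, hshift] at key
  refine key.trans ?_
  have hc : |-(c / m)| ≤ |c| := by
    rw [abs_neg, abs_div]
    exact div_le_self (abs_nonneg _) hm1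
  rw [Fintype.card_coe]
  calc 2 * Q.card * (12 * P * Q.card * h / |b|) * |-(c / m)| / |a|
      ≤ 2 * Q.card * (12 * P * Q.card * h / |b|) * |c| / |a| := by gcongr
    _ = _ := by field_simp; ring

theorem scaleIncrement_eq (hF : IsShiftCount S Q P F) {h : ℝ} (hh : 0 < h) (V : Lattice d → ℝ) :
    scaleIncrement F h V =
      (4 * h)⁻¹ * ((F (-h - h) (-h + h) V - F (-h) h V) + (F (h - h) (h + h) V - F (-h) h V)) := by
  have h1 := hF.add (-h - h) (-h + h) (h + h) V
  have e1 : -h - h = -(2 * h) := by ring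
  have e2 : h - h = -h + h := by ring
  have e3 : h + h = 2 * h := by ring
  rw [e1, e3] at h1
  rw [scaleIncrement, e1, e2, e3, ← h1]
  field_simp
  ring

theorem measurable_scaleIncrement (hF : IsShiftCount S Q P F) {h : ℝ} (hh : 0 < h) :
    Measurable (scaleIncrement F h) :=
  ((hF.measurable (by linarith)).div_const _).sub ((hF.measurable (by linarith)).div_const _)

theorem abs_scaleIncrement_le_add (hF : IsShiftCount S Q P F) {h : ℝ} (hh : 0 < h)
    (V : Lattice d → ℝ) : |scaleIncrement F h V| ≤
      F (-(2 * h)) (2 * h) V / (2 * (2 * h)) + F (-h) h V / (2 * h) := by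
  have h1 : 0 ≤ F (-(2 * h)) (2 * h) V / (2 * (2 * h)) :=
    div_nonneg (hF.nonneg (by linarith) _) (by positivity)
  have h2 : 0 ≤ F (-h) h V / (2 * h) := div_nonneg (hF.nonneg (by linarith) _) (by positivity)
  unfold scaleIncrement
  rw [_root_.abs_le]
  constructor <;> linarith

theorem abs_scaleIncrement_le (hF : IsShiftCount S Q P F) {h : ℝ} (hh : 0 < h)
    (V : Lattice d → ℝ) : |scaleIncrement F h V| ≤ P / h := by
  have hP := hF.bound_nonneg
  refine (hF.abs_scaleIncrement_le_add hh V).trans ?_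
  calc _ ≤ P / (2 * (2 * h)) + P / (2 * h) := by gcongr <;> exact hF.le _ _ _
    _ = 3 / 4 * (P / h) := by field_simp; ring
    _ ≤ P / h := by linarith [div_nonneg hP hh.le]

theorem congr_scaleIncrement (hF : IsShiftCount S Q P F) {h : ℝ} {V V' : Lattice d → ℝ}
    (hV : ∀ x ∈ S, V x = V' x) : scaleIncrement F h V = scaleIncrement F h V' := by
  unfold scaleIncrement
  rw [hF.congr hV, hF.congr hV]

/-- Two independent layers of uniform variables make the expected increment between two scales
small. -/
theorem abs_integral_scaleIncrement_le (hF : IsShiftCount S Q P F) {h a b : ℝ} (hh : 0 < h)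
    (ha : a ≠ 0) (hb : b ≠ 0) (V : Lattice d → ℝ) :
    |∫ ξ, ∫ η, scaleIncrement F h (fun x => V x + spread Q (fun i => a * (ξ i : ℝ)) x +
          spread Q (fun i => b * (η i : ℝ)) x) ∂uniformPi Q ∂uniformPi Q| ≤
      12 * P * Q.card ^ 2 * h / (|a| * |b|) := by
  have hin : Measurable fun q : (Q → unitInterval) × (Q → unitInterval) =>
      fun x => V x + spread Q (fun i => a * (q.1 i : ℝ)) x +
        spread Q (fun i => b * (q.2 i : ℝ)) x := by
    refine measurable_pi_iff.2 fun x => Measurable.add (Measurable.const_add ?_ _) ?_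
    · exact measurable_spread_apply (fun i => by fun_prop) x
    · exact measurable_spread_apply (fun i => by fun_prop) x
  -- the iterated integrals are integrals over the product, where linearity is available
  have hint : ∀ {α β : ℝ}, α ≤ β → Integrable
      (fun q : (Q → unitInterval) × (Q → unitInterval) => F α β
        (fun x => V x + spread Q (fun i => a * (q.1 i : ℝ)) x +
        spread Q (fun i => b * (q.2 i : ℝ)) x)) ((uniformPi Q).prod (uniformPi Q)) :=
    fun {α β} hαβ => Integrable.of_bound ((hF.measurable hαβ).comp hin).aestronglyMeasurable P
      (ae_of_all _ fun q => hF.abs_le hαβ _)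
  have hintD : Integrable (fun q : (Q → unitInterval) × (Q → unitInterval) => scaleIncrement F h
        (fun x => V x + spread Q (fun i => a * (q.1 i : ℝ)) x +
        spread Q (fun i => b * (q.2 i : ℝ)) x)) ((uniformPi Q).prod (uniformPi Q)) :=
    Integrable.of_bound ((hF.measurable_scaleIncrement hh).comp hin).aestronglyMeasurable (P / h)
      (ae_of_all _ fun q => hF.abs_scaleIncrement_le hh _)
  have hdiff : ∀ {α β : ℝ}, α ≤ β → Integrable
      (fun q : (Q → unitInterval) × (Q → unitInterval) => F α β
        (fun x => V x + spread Q (fun i => a * (q.1 i : ℝ)) x +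
        spread Q (fun i => b * (q.2 i : ℝ)) x) - F (-h) h
        (fun x => V x + spread Q (fun i => a * (q.1 i : ℝ)) x +
        spread Q (fun i => b * (q.2 i : ℝ)) x)) ((uniformPi Q).prod (uniformPi Q)) :=
    fun {α β} hαβ => (hint hαβ).sub (hint (by linarith))
  have k1 := hF.abs_integral_translate_sub_le hh ha hb (-h) V
  have k2 := hF.abs_integral_translate_sub_le hh ha hb h V
  rw [← integral_prod _ (hint (by linarith : -h ≤ h))] at k1 k2
  rw [← integral_prod _ (hint (by linarith : -h - h ≤ -h + h)),
    ← integral_sub (hint (by linarith)) (hint (by linarith))] at k1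
  rw [← integral_prod _ (hint (by linarith : h - h ≤ h + h)),
    ← integral_sub (hint (by linarith)) (hint (by linarith))] at k2
  rw [← integral_prod _ hintD]
  simp only [hF.scaleIncrement_eq hh]
  rw [integral_const_mul, integral_add (hdiff (by linarith)) (hdiff (by linarith)), abs_mul, abs_of_pos (by positivity)]
  rw [abs_neg] at k1
  rw [abs_of_pos hh] at k1 k2
  calc _ ≤ (4 * h)⁻¹ * (24 * P * Q.card ^ 2 * h * h / (|a| * |b|) +
        24 * P * Q.card ^ 2 * h * h / (|a| * |b|)) := by
        gcongr
        exact (abs_add_le _ _).trans (add_le_add k1 k2)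
    _ = _ := by field_simp; ring

end IsShiftCount
end ShiftCount

/-! ### Moments of the normalized eigenvalue counts -/

section Moments

variable {d ν : ℕ}

instance isProbabilityMeasure_paramMeasure : IsProbabilityMeasure (paramMeasure ν) := by
  unfold paramMeasure
  infer_instance

theorem cellIndex_ne_of_le_dist {n m : ℕ+} (hnm : n ≤ m) {ω ω' : UnitAddTorus (Fin ν)}
    (h : (1 / 2 : ℝ) ^ (n : ℕ) ≤ dist ω ω') : cellIndex m ω ≠ cellIndex m ω' := by
  intro he
  have h1 := dist_lt_of_cellIndex_eq he
  have h2 : (1 / 2 : ℝ) ^ (m : ℕ) ≤ (1 / 2) ^ (n : ℕ) :=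
    pow_le_pow_of_le_one (by norm_num) (by norm_num) (PNat.coe_le_coe _ _ |>.2 hnm)
  linarith

theorem extend_comm {ι κ I : Type*} {e : ι → I} {e' : κ → I} (hne : ∀ x y, e x ≠ e' y)
    (ξ : ι → unitInterval) (η : κ → unitInterval) (θ : I → unitInterval) :
    Function.extend e ξ (Function.extend e' η θ) = Function.extend e' η (Function.extend e ξ θ) := by
  classical
  funext i
  by_cases h : ∃ x, e x = i
  · have h' : ¬ ∃ y, e' y = i := fun ⟨y, hy⟩ => by
      obtain ⟨x, hx⟩ := h
      exact hne x y (hx.trans hy.symm)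
    simp only [Function.extend_def, dif_pos h, dif_neg h']
  · by_cases h' : ∃ y, e' y = i
    · simp only [Function.extend_def, dif_neg h, dif_pos h']
    · simp only [Function.extend_def, dif_neg h, dif_neg h']

variable {a : ℕ+ → ℝ} {T : Lattice d → UnitAddTorus (Fin ν) → UnitAddTorus (Fin ν)}
  {S Q : Finset (Lattice d)} {P : ℝ} {F : ℝ → ℝ → (Lattice d → ℝ) → ℝ}

/-- The average over the torus of the number of points within distance `h` of zero, divided by the
length `2 * h` of the interval. -/
noncomputable def scaledCount (a : ℕ+ → ℝ)
    (T : Lattice d → UnitAddTorus (Fin ν) → UnitAddTorus (Fin ν))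
    (F : ℝ → ℝ → (Lattice d → ℝ) → ℝ) (h : ℝ) (θ : Param ν) : ℝ :=
  ∫ ω, F (-h) h (potential a T ω θ) / (2 * h)

theorem measurable_potential_right (ha : Summable fun n => |a n|) (hT : ∀ x, Measurable (T x))
    (ω : UnitAddTorus (Fin ν)) : Measurable fun θ : Param ν => potential a T ω θ :=
  (measurable_potential ha hT).comp measurable_prodMk_left

theorem measurable_potential_left (ha : Summable fun n => |a n|) (hT : ∀ x, Measurable (T x))
    (θ : Param ν) : Measurable fun ω : UnitAddTorus (Fin ν) => potential a T ω θ :=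
  (measurable_potential ha hT).comp measurable_prodMk_right

namespace IsShiftCount

theorem measurable_scaledCount (hF : IsShiftCount S Q P F) (ha : Summable fun n => |a n|)
    (hT : ∀ x, Measurable (T x)) {h : ℝ} (hh : 0 < h) : Measurable (scaledCount a T F h) := by
  have hm : StronglyMeasurable fun p : UnitAddTorus (Fin ν) × Param ν =>
      F (-h) h (potential a T p.1 p.2) / (2 * h) :=
    (((hF.measurable (by linarith)).comp (measurable_potential ha hT)).div_const _).stronglyMeasurable
  exact hm.integral_prod_left'.measurable

theorem scaledCount_nonneg (hF : IsShiftCount S Q P F) {h : ℝ} (hh : 0 < h) (θ : Param ν) :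
    0 ≤ scaledCount a T F h θ :=
  integral_nonneg fun _ => div_nonneg (hF.nonneg (by linarith) _) (by positivity)

/-- The Wegner estimate at a fixed point of the torus: the cells of a single level that are visited
by the orbit provide enough randomness. -/
theorem integral_param_le (hF : IsShiftCount S Q P F) (ha : Summable fun n => |a n|)
    (hT : ∀ x, Measurable (T x)) {n : ℕ+} (han : a n ≠ 0) {ω : UnitAddTorus (Fin ν)}
    (hcell : ∀ x ∈ S, ∀ y ∈ S, x ≠ y → cellIndex n (T x ω) ≠ cellIndex n (T y ω))
    {h : ℝ} (hh : 0 < h) :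
    ∫ θ, F (-h) h (potential a T ω θ) ∂paramMeasure ν ≤ 12 * P * Q.card * h / |a n| := by
  have hinj := injective_orbitCells (T := T) (n := n) (ω := ω)
    fun x hx y hy => hcell x (hF.subset hx) y (hF.subset hy)
  have hmeas := (hF.measurable (by linarith : -h ≤ h)).comp (measurable_potential_right ha hT ω)
  refine (integral_resample hinj hmeas (C := P) fun θ => hF.abs_le (by linarith) _).trans_le ?_
  refine (integral_mono_of_nonneg (g := fun _ => 12 * P * Q.card * h / |a n|)
    (ae_of_all _ fun θ => integral_nonneg fun ξ => hF.nonneg (by linarith) _)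
    (integrable_const _) (ae_of_all _ fun θ => ?_)).trans (le_of_eq (by simp))
  refine le_trans (le_of_eq (integral_congr_ae (ae_of_all _ fun ξ => ?_)))
    (hF.integral_le hh han (potential a T ω (Function.extend (orbitCells T Q n ω) (fun _ => 0) θ)))
  exact hF.congr fun y hy =>
    potential_extend ha (fun x hx y hy => hcell x (hF.subset hx) y hy) hF.subset ξ θ hy

theorem integral_scaledCount_le (hF : IsShiftCount S Q P F) (ha : Summable fun n => |a n|)
    (hT : ∀ x, Measurable (T x)) {n : ℕ+} (han : a n ≠ 0)
    (hcell : ∀ ω, ∀ x ∈ S, ∀ y ∈ S, x ≠ y → cellIndex n (T x ω) ≠ cellIndex n (T y ω))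
    {h : ℝ} (hh : 0 < h) :
    ∫ θ, scaledCount a T F h θ ∂paramMeasure ν ≤ 6 * P * Q.card / |a n| := by
  have hint : Integrable (Function.uncurry fun (θ : Param ν) (ω : UnitAddTorus (Fin ν)) =>
      F (-h) h (potential a T ω θ) / (2 * h)) ((paramMeasure ν).prod volume) := by
    refine Integrable.of_bound (C := P / (2 * h)) ?_ (ae_of_all _ fun p => ?_)
    · exact (((hF.measurable (by linarith)).comp
        ((measurable_potential ha hT).comp measurable_swap)).div_const _).aestronglyMeasurable
    · simp only [Function.uncurry, Real.norm_eq_abs, abs_div, abs_of_pos (by positivity : 0 < 2 * h)]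
      gcongr
      exact hF.abs_le (by linarith) _
  unfold scaledCount
  rw [integral_integral_swap hint]
  refine (integral_mono_of_nonneg (g := fun _ => 6 * P * Q.card / |a n|)
    (ae_of_all _ fun ω => integral_nonneg fun θ =>
      div_nonneg (hF.nonneg (by linarith) _) (by positivity))
    (integrable_const _) (ae_of_all _ fun ω => ?_)).trans (le_of_eq (by simp))
  simp only [integral_div]
  rw [div_le_iff₀ (by positivity)]
  refine (hF.integral_param_le ha hT han (hcell ω) hh).trans (le_of_eq ?_)
  ring

/-- If the orbits of `ω` and `ω'` visit different cells at two consecutive levels, then the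
increments at `ω` and `ω'` are almost uncorrelated. -/
theorem abs_integral_mul_le (hF : IsShiftCount S Q P F) (ha : Summable fun n => |a n|)
    (hT : ∀ x, Measurable (T x)) {n : ℕ+} (han : a n ≠ 0) (han' : a (n + 1) ≠ 0)
    {ω ω' : UnitAddTorus (Fin ν)}
    (hω : ∀ m, n ≤ m → ∀ x ∈ S, ∀ y ∈ S, x ≠ y → cellIndex m (T x ω) ≠ cellIndex m (T y ω))
    (hω' : ∀ x ∈ S, ∀ y ∈ S, x ≠ y → cellIndex n (T x ω') ≠ cellIndex n (T y ω'))
    (hωω' : ∀ m, n ≤ m → ∀ x ∈ S, ∀ y ∈ S, cellIndex m (T x ω) ≠ cellIndex m (T y ω'))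
    {h : ℝ} (hh : 0 < h) :
    |∫ θ, scaleIncrement F h (potential a T ω θ) * scaleIncrement F h (potential a T ω' θ)
        ∂paramMeasure ν| ≤
      144 * P ^ 2 * Q.card ^ 3 * h / (|a n| ^ 2 * |a (n + 1)|) := by
  have hP := hF.bound_nonneg
  have hn1 : n ≤ n + 1 := (PNat.lt_add_right n 1).le
  set e := orbitCells T Q n ω with he
  set e' := orbitCells T Q (n + 1) ω with he'
  have hinj : Function.Injective e := injective_orbitCells
    fun x hx y hy => hω n le_rfl x (hF.subset hx) y (hF.subset hy)
  have hinj' : Function.Injective e' := injective_orbitCells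
    fun x hx y hy => hω (n + 1) hn1 x (hF.subset hx) y (hF.subset hy)
  have hee' : ∀ x y, e' x ≠ e y := fun x y hxy => by
    have : n + 1 = n := congrArg Sigma.fst hxy
    exact absurd this (PNat.lt_add_right n 1).ne'
  set D : Param ν → ℝ := fun θ => scaleIncrement F h (potential a T ω θ) with hD
  set D' : Param ν → ℝ := fun θ => scaleIncrement F h (potential a T ω' θ) with hD'
  have hDm : Measurable D :=
    (hF.measurable_scaleIncrement hh).comp (measurable_potential_right ha hT ω)
  have hDm' : Measurable D' :=
    (hF.measurable_scaleIncrement hh).comp (measurable_potential_right ha hT ω')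
  have hDb : ∀ θ, |D θ| ≤ P / h := fun θ => hF.abs_scaleIncrement_le hh _
  have hDb' : ∀ θ, |D' θ| ≤ P / h := fun θ => hF.abs_scaleIncrement_le hh _
  have hPh : 0 ≤ P / h := div_nonneg hP hh.le
  -- the second factor is not affected by resampling along the orbit of `ω`
  have hinv : ∀ ξ θ, D' (Function.extend e ξ θ) = D' θ := fun ξ θ =>
    hF.congr_scaleIncrement fun y hy => potential_extend_of_ne
      (fun x hx y hy => hωω' n le_rfl x (hF.subset hx) y hy) ξ θ hy
  have hinv' : ∀ η θ, D' (Function.extend e' η θ) = D' θ := fun η θ =>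
    hF.congr_scaleIncrement fun y hy => potential_extend_of_ne
      (fun x hx y hy => hωω' (n + 1) hn1 x (hF.subset hx) y hy) η θ hy
  set K : Param ν → ℝ := fun θ => ∫ η, D (Function.extend e' η θ) ∂uniformPi Q with hK
  have hKm : Measurable K := by
    have hm : StronglyMeasurable fun p : (Q → unitInterval) × Param ν =>
        D (Function.extend e' p.1 p.2) :=
      (hDm.comp (measurable_extend_uncurry e')).stronglyMeasurable
    exact hm.integral_prod_left'.measurable
  have hKb : ∀ θ, |K θ| ≤ P / h := fun θ => by
    have := norm_integral_le_of_norm_le_const (μ := uniformPi Q) (C := P / h)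
      (f := fun η => D (Function.extend e' η θ)) (ae_of_all _ fun η => hDb _)
    simpa using this
  have step1 : ∫ θ, D θ * D' θ ∂paramMeasure ν = ∫ θ, K θ * D' θ ∂paramMeasure ν := by
    refine (integral_resample hinj' (hDm.mul hDm') (C := P / h * (P / h)) fun θ => by
      rw [Pi.mul_apply, abs_mul]
      exact mul_le_mul (hDb θ) (hDb' θ) (abs_nonneg _) hPh).trans ?_
    refine integral_congr_ae (ae_of_all _ fun θ => ?_)
    simp only [Pi.mul_apply, hinv', hK]
    exact integral_mul_const _ _
  have step2 : ∫ θ, K θ * D' θ ∂paramMeasure ν =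
      ∫ θ, (∫ ξ, K (Function.extend e ξ θ) ∂uniformPi Q) * D' θ ∂paramMeasure ν := by
    refine (integral_resample hinj (hKm.mul hDm') (C := P / h * (P / h)) fun θ => by
      rw [Pi.mul_apply, abs_mul]
      exact mul_le_mul (hKb θ) (hDb' θ) (abs_nonneg _) hPh).trans ?_
    refine integral_congr_ae (ae_of_all _ fun θ => ?_)
    simp only [Pi.mul_apply, hinv]
    exact integral_mul_const _ _
  have hin : ∀ θ, |∫ ξ, K (Function.extend e ξ θ) ∂uniformPi Q| ≤
      12 * P * Q.card ^ 2 * h / (|a n| * |a (n + 1)|) := by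
    intro θ
    refine le_trans (le_of_eq (congrArg abs ?_)) (hF.abs_integral_scaleIncrement_le hh han han'
      (potential a T ω (Function.extend e (fun _ => 0) (Function.extend e' (fun _ => 0) θ))))
    refine integral_congr_ae (ae_of_all _ fun ξ => integral_congr_ae (ae_of_all _ fun η => ?_))
    refine hF.congr_scaleIncrement fun y hy => ?_
    rw [he', potential_extend ha (fun x hx y hy => hω (n + 1) hn1 x (hF.subset hx) y hy) hF.subset
      η _ hy, ← he', extend_comm hee', he,
      potential_extend ha (fun x hx y hy => hω n le_rfl x (hF.subset hx) y hy) hF.subset ξ _ hy]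
  have hD'1 : ∫ θ, |D' θ| ∂paramMeasure ν ≤ 12 * P * Q.card / |a n| := by
    have hi : ∀ {α β : ℝ}, α ≤ β →
        Integrable (fun θ => F α β (potential a T ω' θ)) (paramMeasure ν) := fun {α β} hαβ =>
      Integrable.of_bound ((hF.measurable hαβ).comp
        (measurable_potential_right ha hT ω')).aestronglyMeasurable P
        (ae_of_all _ fun θ => hF.abs_le hαβ _)
    have hi1 := hi (by linarith : -(2 * h) ≤ 2 * h)
    have hi2 := hi (by linarith : -h ≤ h)
    have hle := integral_mono_of_nonneg (ae_of_all _ fun θ => abs_nonneg (D' θ))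
      ((hi1.div_const (2 * (2 * h))).add (hi2.div_const (2 * h)))
      (ae_of_all _ fun θ => hF.abs_scaleIncrement_le_add hh _)
    refine hle.trans ?_
    rw [integral_add' (hi1.div_const _) (hi2.div_const _), integral_div, integral_div]
    have b1 := hF.integral_param_le ha hT han hω' (by linarith : 0 < 2 * h)
    have b2 := hF.integral_param_le ha hT han hω' hh
    have hap : 0 < |a n| := abs_pos.2 han
    calc _ ≤ 12 * P * Q.card * (2 * h) / |a n| / (2 * (2 * h)) +
          12 * P * Q.card * h / |a n| / (2 * h) := by gcongr
      _ = _ := by field_simp; ring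
  rw [step1, step2]
  have hD'int : Integrable D' (paramMeasure ν) :=
    Integrable.of_bound hDm'.aestronglyMeasurable _ (ae_of_all _ hDb')
  calc _ ≤ ∫ θ, |(∫ ξ, K (Function.extend e ξ θ) ∂uniformPi Q) * D' θ| ∂paramMeasure ν :=
        abs_integral_le_integral_abs
    _ ≤ ∫ θ, 12 * P * Q.card ^ 2 * h / (|a n| * |a (n + 1)|) * |D' θ| ∂paramMeasure ν := by
        refine integral_mono_of_nonneg (ae_of_all _ fun θ => abs_nonneg _)
          (hD'int.abs.const_mul _) (ae_of_all _ fun θ => ?_)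
        simp only [abs_mul]
        exact mul_le_mul_of_nonneg_right (hin θ) (abs_nonneg _)
    _ ≤ 12 * P * Q.card ^ 2 * h / (|a n| * |a (n + 1)|) * (12 * P * Q.card / |a n|) := by
        rw [integral_const_mul]
        gcongr
    _ = _ := by
        have hap : |a n| ≠ 0 := abs_ne_zero.2 han
        have hap' : |a (n + 1)| ≠ 0 := abs_ne_zero.2 han'
        field_simp
        ring

/-- The second moment of the increment of the normalized count is small: the contribution of pairs
of points with separated orbits is small by decorrelation, and the other pairs are rare. -/
theorem integral_sq_scaledCount_sub_le (hF : IsShiftCount S Q P F) (hν : 1 ≤ ν)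
    (ha : Summable fun n => |a n|) (ha0 : ∀ n, a n ≠ 0)
    (hT : ∀ x, MeasurePreserving (T x) volume volume) {n : ℕ+}
    (hsep : ∀ ω, ∀ x ∈ S, ∀ y ∈ S, x ≠ y → (1 / 2 : ℝ) ^ (n : ℕ) ≤ dist (T x ω) (T y ω))
    {h : ℝ} (hh : 0 < h) :
    ∫ θ, (scaledCount a T F (2 * h) θ - scaledCount a T F h θ) ^ 2 ∂paramMeasure ν ≤
      144 * P ^ 2 * Q.card ^ 3 * h / (|a n| ^ 2 * |a (n + 1)|) +
        (P / h) ^ 2 * (S.card ^ 2 * (2 * (1 / 2) ^ (n : ℕ))) := by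
  have hTm : ∀ x, Measurable (T x) := fun x => (hT x).measurable
  have hP := hF.bound_nonneg
  have hPh : 0 ≤ P / h := div_nonneg hP hh.le
  set H : Param ν → UnitAddTorus (Fin ν) → ℝ :=
    fun θ ω => scaleIncrement F h (potential a T ω θ) with hH
  have hHb : ∀ θ ω, |H θ ω| ≤ P / h := fun θ ω => hF.abs_scaleIncrement_le hh _
  have hHm : Measurable fun p : Param ν × UnitAddTorus (Fin ν) => H p.1 p.2 :=
    (hF.measurable_scaleIncrement hh).comp ((measurable_potential ha hTm).comp measurable_swap)
  have hdiff : ∀ θ, scaledCount a T F (2 * h) θ - scaledCount a T F h θ = ∫ ω, H θ ω := by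
    intro θ
    have hi : ∀ {α β : ℝ}, α ≤ β →
        Integrable (fun ω : UnitAddTorus (Fin ν) => F α β (potential a T ω θ)) :=
      fun {α β} hαβ => Integrable.of_bound ((hF.measurable hαβ).comp
        (measurable_potential_left ha hTm θ)).aestronglyMeasurable P
        (ae_of_all _ fun ω => hF.abs_le hαβ _)
    unfold scaledCount
    rw [← integral_sub ((hi (by linarith)).div_const _) ((hi (by linarith)).div_const _)]
    rfl
  have hsq : ∀ θ, (scaledCount a T F (2 * h) θ - scaledCount a T F h θ) ^ 2 =
      ∫ p : UnitAddTorus (Fin ν) × UnitAddTorus (Fin ν), H θ p.1 * H θ p.2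
        ∂(volume.prod volume) := by
    intro θ
    rw [hdiff, sq, integral_prod_mul]
  simp only [hsq]
  have hint : Integrable (Function.uncurry fun (θ : Param ν)
      (p : UnitAddTorus (Fin ν) × UnitAddTorus (Fin ν)) => H θ p.1 * H θ p.2)
      ((paramMeasure ν).prod (volume.prod volume)) := by
    refine Integrable.of_bound (C := P / h * (P / h)) ?_ (ae_of_all _ fun q => ?_)
    · have m1 : Measurable fun q : Param ν × UnitAddTorus (Fin ν) × UnitAddTorus (Fin ν) =>
          (q.1, q.2.1) := measurable_fst.prodMk (measurable_fst.comp measurable_snd)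
      have m2 : Measurable fun q : Param ν × UnitAddTorus (Fin ν) × UnitAddTorus (Fin ν) =>
          (q.1, q.2.2) := measurable_fst.prodMk (measurable_snd.comp measurable_snd)
      have m3 := (hHm.comp m1).mul (hHm.comp m2)
      exact m3.aestronglyMeasurable
    · rw [Function.uncurry, Real.norm_eq_abs, abs_mul]
      exact mul_le_mul (hHb _ _) (hHb _ _) (abs_nonneg _) hPh
  rw [integral_integral_swap hint]
  set B := 144 * P ^ 2 * Q.card ^ 3 * h / (|a n| ^ 2 * |a (n + 1)|) with hB
  have hB0 : 0 ≤ B := by positivity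
  set bad := closePairs T S ((1 / 2 : ℝ) ^ (n : ℕ)) with hbad
  have hbadm : MeasurableSet bad := measurableSet_closePairs hTm S _
  have hbadint : Integrable (bad.indicator fun _ => (P / h) ^ 2) (volume.prod volume) :=
    (integrable_const _).indicator hbadm
  have hpt : ∀ p : UnitAddTorus (Fin ν) × UnitAddTorus (Fin ν),
      ∫ θ, H θ p.1 * H θ p.2 ∂paramMeasure ν ≤ B + bad.indicator (fun _ => (P / h) ^ 2) p := by
    intro p
    by_cases hp : p ∈ bad
    · rw [Set.indicator_of_mem hp]
      have h1 : ∫ θ, H θ p.1 * H θ p.2 ∂paramMeasure ν ≤ (P / h) ^ 2 := by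
        have := norm_integral_le_of_norm_le_const (μ := paramMeasure ν) (C := (P / h) ^ 2)
          (f := fun θ => H θ p.1 * H θ p.2) (ae_of_all _ fun θ => by
            rw [norm_mul, sq]
            exact mul_le_mul (hHb _ _) (hHb _ _) (norm_nonneg _) hPh)
        rw [probReal_univ, mul_one] at this
        exact (le_abs_self _).trans this
      linarith
    · rw [Set.indicator_of_notMem hp, add_zero]
      have hfar : ∀ x ∈ S, ∀ y ∈ S, (1 / 2 : ℝ) ^ (n : ℕ) ≤ dist (T x p.1) (T y p.2) := by
        intro x hx y hy
        by_contra hlt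
        exact hp ⟨x, hx, y, hy, not_le.1 hlt⟩
      exact (le_abs_self _).trans (hF.abs_integral_mul_le ha hTm (ha0 n) (ha0 (n + 1))
        (fun m hm x hx y hy hxy => cellIndex_ne_of_le_dist hm (hsep _ x hx y hy hxy))
        (fun x hx y hy hxy => cellIndex_ne_of_le_dist le_rfl (hsep _ x hx y hy hxy))
        (fun m hm x hx y hy => cellIndex_ne_of_le_dist hm (hfar x hx y hy)) hh)
  refine (integral_mono hint.integral_prod_right ((integrable_const B).add hbadint) hpt).trans ?_
  rw [integral_add' (integrable_const B) hbadint, integral_const, probReal_univ, one_smul,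
    integral_indicator hbadm, setIntegral_const, smul_eq_mul, mul_comm _ ((P / h) ^ 2)]
  gcongr
  exact volume_closePairs_le hν hT S (by positivity)

end IsShiftCount
end Moments

/-! ### Uniform control over all scales -/

section AllScales

theorem integral_abs_le_of_integral_sq_le {Θ : Type*} [MeasurableSpace Θ] {μ : Measure Θ}
    [IsProbabilityMeasure μ] {f : Θ → ℝ} (hf : Integrable (fun θ => f θ ^ 2) μ) {s : ℝ} (hs : 0 < s)
    (h : ∫ θ, f θ ^ 2 ∂μ ≤ s ^ 2) : ∫ θ, |f θ| ∂μ ≤ s := by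
  have hi : Integrable (fun θ => (2 * s)⁻¹ * f θ ^ 2 + s / 2) μ :=
    (hf.const_mul _).add (integrable_const _)
  have hle : ∫ θ, |f θ| ∂μ ≤ ∫ θ, ((2 * s)⁻¹ * f θ ^ 2 + s / 2) ∂μ := by
    refine integral_mono_of_nonneg (ae_of_all _ fun θ => abs_nonneg _) hi (ae_of_all _ fun θ => ?_)
    simp only
    rw [← sub_nonneg, ← sq_abs]
    have : (2 * s)⁻¹ * |f θ| ^ 2 + s / 2 - |f θ| = (2 * s)⁻¹ * (|f θ| - s) ^ 2 := by
      field_simp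
      ring
    rw [this]
    positivity
  refine hle.trans ?_
  rw [integral_add (hf.const_mul _) (integrable_const _), integral_const_mul, integral_const,
    probReal_univ, one_smul]
  calc (2 * s)⁻¹ * ∫ θ, f θ ^ 2 ∂μ + s / 2 ≤ (2 * s)⁻¹ * s ^ 2 + s / 2 := by gcongr
    _ = s := by field_simp; norm_num

/-- A sequence of nonnegative random variables whose first terms have bounded expectations and
whose later increments are summable in mean is uniformly bounded outside of an event of small
probability. -/
theorem exists_uniform_bound {Θ : Type*} [MeasurableSpace Θ] {μ : Measure Θ}
    [IsProbabilityMeasure μ] {R : ℕ → Θ → ℝ} (hm : ∀ j, Measurable (R j))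
    (hint : ∀ j, Integrable (R j) μ) (h0 : ∀ j θ, 0 ≤ R j θ) {L : ℕ} {A lam : ℝ} (hlam : 0 < lam)
    (hA : ∀ j ≤ L, ∫ θ, R j θ ∂μ ≤ A) {b : ℕ → ℝ} (hb : Summable b)
    (hinc : ∀ k, ∫ θ, |R (L + k + 1) θ - R (L + k) θ| ∂μ ≤ b k) :
    ∃ G : Set Θ, MeasurableSet G ∧ 1 - ((L + 1) * A + ∑' k, b k) / lam ≤ μ.real G ∧
      ∀ θ ∈ G, ∀ j, R j θ ≤ lam := by
  have hA0 : 0 ≤ A := (integral_nonneg (h0 0)).trans (hA 0 (Nat.zero_le _))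
  have hb0 : ∀ k, 0 ≤ b k := fun k => (integral_nonneg fun θ => abs_nonneg _).trans (hinc k)
  set Z : Θ → ENNReal := fun θ => ∑ j ∈ Finset.range (L + 1), ENNReal.ofReal (R j θ) +
    ∑' k, ENNReal.ofReal |R (L + k + 1) θ - R (L + k) θ| with hZ
  have hm1 : ∀ j, Measurable fun θ => ENNReal.ofReal (R j θ) := fun j => (hm j).ennreal_ofReal
  have hm2 : ∀ k, Measurable fun θ => ENNReal.ofReal |R (L + k + 1) θ - R (L + k) θ| :=
    fun k => (continuous_abs.measurable.comp ((hm _).sub (hm _))).ennreal_ofReal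
  have hZm : Measurable Z :=
    (Finset.measurable_sum _ fun j _ => hm1 j).add (Measurable.tsum hm2)
  have hZint : ∫⁻ θ, Z θ ∂μ ≤ ENNReal.ofReal ((L + 1) * A + ∑' k, b k) := by
    rw [hZ, lintegral_add_right _ (Measurable.tsum hm2),
      lintegral_finsetSum _ fun j _ => hm1 j, lintegral_tsum fun k => (hm2 k).aemeasurable,
      ENNReal.ofReal_add (by positivity) (tsum_nonneg hb0), ENNReal.ofReal_tsum_of_nonneg hb0 hb]
    gcongr with k
    · calc _ ≤ ∑ j ∈ Finset.range (L + 1), ENNReal.ofReal A := by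
            refine Finset.sum_le_sum fun j hj => ?_
            rw [← ofReal_integral_eq_lintegral_ofReal (hint j) (ae_of_all _ (h0 j))]
            exact ENNReal.ofReal_le_ofReal (hA j (Nat.lt_succ_iff.1 (Finset.mem_range.1 hj)))
        _ = ENNReal.ofReal ((L + 1) * A) := by
            rw [Finset.sum_const, Finset.card_range, nsmul_eq_mul,
              ENNReal.ofReal_mul (by positivity)]
            congr 1
            exact_mod_cast (ENNReal.ofReal_natCast (L + 1)).symm
    · have hi : Integrable (fun θ => |R (L + k + 1) θ - R (L + k) θ|) μ :=
        ((hint _).sub (hint _)).abs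
      rw [← ofReal_integral_eq_lintegral_ofReal hi (ae_of_all _ fun θ => abs_nonneg _)]
      exact ENNReal.ofReal_le_ofReal (hinc k)
  refine ⟨{θ | Z θ ≤ ENNReal.ofReal lam}, measurableSet_le hZm measurable_const, ?_, ?_⟩
  · have hG : MeasurableSet {θ | Z θ ≤ ENNReal.ofReal lam} := measurableSet_le hZm measurable_const
    have hsub : {θ | Z θ ≤ ENNReal.ofReal lam}ᶜ ⊆ {θ | ENNReal.ofReal lam ≤ Z θ} :=
      fun θ hθ => le_of_lt (show ENNReal.ofReal lam < Z θ from not_le.1 hθ)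
    have hmk := (mul_meas_ge_le_lintegral hZm (ENNReal.ofReal lam) (μ := μ)).trans hZint
    have hreal : lam * μ.real {θ | ENNReal.ofReal lam ≤ Z θ} ≤ (L + 1) * A + ∑' k, b k := by
      have := ENNReal.toReal_le_of_le_ofReal
        (add_nonneg (by positivity) (tsum_nonneg hb0)) hmk
      rwa [ENNReal.toReal_mul, ENNReal.toReal_ofReal hlam.le] at this
    have h1 : μ.real {θ | Z θ ≤ ENNReal.ofReal lam}ᶜ ≤ ((L + 1) * A + ∑' k, b k) / lam := by
      rw [le_div_iff₀ hlam, mul_comm]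
      exact (mul_le_mul_of_nonneg_left (measureReal_mono hsub) hlam.le).trans hreal
    rw [probReal_compl_eq_one_sub hG] at h1
    linarith
  · intro θ hθ
    have hθ' : Z θ ≤ ENNReal.ofReal lam := hθ
    have hfirst : ∀ j ≤ L, R j θ ≤ lam := by
      intro j hj
      refine (ENNReal.ofReal_le_ofReal_iff hlam.le).1 (le_trans ?_ hθ')
      refine le_trans ?_ le_self_add
      exact Finset.single_le_sum (f := fun j => ENNReal.ofReal (R j θ)) (fun _ _ => zero_le)
        (Finset.mem_range.2 (Nat.lt_succ_iff.2 hj))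
    have hlater : ∀ k, ENNReal.ofReal (R (L + k) θ) ≤ ENNReal.ofReal (R L θ) +
        ∑ i ∈ Finset.range k, ENNReal.ofReal |R (L + i + 1) θ - R (L + i) θ| := by
      intro k
      induction k with
      | zero => simp
      | succ k ih =>
        rw [Finset.sum_range_succ, ← add_assoc (ENNReal.ofReal (R L θ))]
        refine le_trans ?_ (add_le_add ih le_rfl)
        rw [← ENNReal.ofReal_add (h0 _ _) (abs_nonneg _)]
        refine ENNReal.ofReal_le_ofReal ?_
        have := le_abs_self (R (L + k + 1) θ - R (L + k) θ)
        rw [← add_assoc L k 1]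
        linarith
    intro j
    rcases le_or_gt j L with hj | hj
    · exact hfirst j hj
    · obtain ⟨k, rfl⟩ := Nat.exists_eq_add_of_lt hj
      refine (ENNReal.ofReal_le_ofReal_iff hlam.le).1 (le_trans ?_ hθ')
      refine (hlater (k + 1)).trans (add_le_add ?_ (ENNReal.sum_le_tsum _))
      exact Finset.single_le_sum (f := fun j => ENNReal.ofReal (R j θ)) (fun _ _ => zero_le)
        (Finset.mem_range.2 (Nat.lt_succ_self L))

theorem exists_rpow_le_mul_pow (q : ℝ) {ρ : ℝ} (hρ : 1 < ρ) :
    ∃ C : ℝ, 0 < C ∧ ∀ n : ℕ, 1 ≤ n → (n : ℝ) ^ q ≤ C * ρ ^ n := by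
  obtain ⟨C, hC⟩ := (tendsto_pow_const_div_const_pow_of_one_lt ⌈q⌉₊ hρ).bddAbove_range
  refine ⟨max C 1, by positivity, fun n hn => ?_⟩
  have hpos : 0 < ρ ^ n := by positivity
  have h1 : (n : ℝ) ^ q ≤ (n : ℝ) ^ ⌈q⌉₊ := by
    rw [← Real.rpow_natCast]
    exact Real.rpow_le_rpow_of_exponent_le (by exact_mod_cast hn) (Nat.le_ceil q)
  have h2 : (n : ℝ) ^ ⌈q⌉₊ / ρ ^ n ≤ C := hC ⟨n, rfl⟩
  rw [div_le_iff₀ hpos] at h2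
  exact h1.trans (h2.trans (mul_le_mul_of_nonneg_right (le_max_left _ _) hpos.le))

/-- The second moment bound of the increments, in terms of `L` and of the scale `2 ^ (-i)`, for the
level `n = K * L + 3 * i`. The summand `K * L` separates the points of an orbit, and the summand
`3 * i` makes `2 ^ (-n)` smaller than the cube of the scale. The polynomial growth of the inverse
amplitudes in `i` is absorbed by replacing `2 ^ (-i)` with `(9 / 16) ^ i`. -/
theorem exists_increment_bound (d K : ℕ) {a : ℕ+ → ℝ} {c M : ℝ} (hc : 0 < c) (hM : 0 ≤ M)
    (ha : ∀ n : ℕ+, c / (n : ℝ) ^ M ≤ |a n|) :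
    ∃ C : ℝ, 0 < C ∧ ∀ (L i q s : ℕ) (n : ℕ+), 1 ≤ L → 1 ≤ i → q ≤ 4 * (2 * L + 1) ^ d →
      s ≤ 4 * (2 * L + 1) ^ d → (n : ℕ) = K * L + 3 * i →
      144 * (((2 * L + 1) ^ d) ^ 4 : ℝ) ^ 2 * (q : ℝ) ^ 3 * (1 / 2) ^ i /
          (|a n| ^ 2 * |a (n + 1)|) +
        ((((2 * L + 1) ^ d) ^ 4 : ℝ) / (1 / 2) ^ i) ^ 2 *
          ((s : ℝ) ^ 2 * (2 * (1 / 2) ^ (n : ℕ))) ≤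
        (C * (L : ℝ) ^ ((11 * d + 3 * M) / 2) * (3 / 4) ^ i) ^ 2 := by
  obtain ⟨C₁, hC₁, hC₁'⟩ := exists_rpow_le_mul_pow (3 * M) (by norm_num : (1 : ℝ) < 9 / 8)
  set D : ℝ := 9216 * (3 ^ d) ^ 11 * (((K : ℝ) + 4) ^ (3 * M) * C₁ / c ^ 3) + 32 * (3 ^ d) ^ 11
    with hD
  have hD0 : 0 < D := by positivity
  refine ⟨Real.sqrt D, Real.sqrt_pos.2 hD0, fun L i q s n hL hi hq hs hn => ?_⟩
  have hL1 : (1 : ℝ) ≤ L := by exact_mod_cast hL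
  have hi1 : (1 : ℝ) ≤ i := by exact_mod_cast hi
  set p : ℝ := (2 * (L : ℝ) + 1) ^ d with hp
  have hp1 : 1 ≤ p := one_le_pow₀ (by linarith)
  have hpL : p ≤ 3 ^ d * (L : ℝ) ^ d := by
    rw [← mul_pow]
    exact pow_le_pow_left₀ (by positivity) (by linarith) d
  have hq' : (q : ℝ) ≤ 4 * p := by rw [hp]; exact_mod_cast hq
  have hs' : (s : ℝ) ≤ 4 * p := by rw [hp]; exact_mod_cast hs
  -- lower bounds for the amplitudes
  set x : ℝ := ((K : ℝ) + 4) * L * i with hx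
  have hx0 : 0 < x := by positivity
  have hinv : ∀ m : ℕ+, (m : ℝ) ≤ x → c / x ^ M ≤ |a m| := by
    intro m hmx
    refine le_trans ?_ (ha m)
    have hm0 : (0 : ℝ) < m := by exact_mod_cast m.pos
    gcongr
  have hnr : ((n : ℕ) : ℝ) = K * L + 3 * i := by rw [hn]; push_cast; ring
  have hLi : (L : ℝ) ≤ L * i := le_mul_of_one_le_right (by positivity) hi1
  have hiL : (i : ℝ) ≤ L * i := le_mul_of_one_le_left (by positivity) hL1
  have hKLi : (K : ℝ) * L ≤ K * (L * i) := by gcongr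
  have hb1 := hinv n (by rw [hnr, hx]; nlinarith)
  have hb2 := hinv (n + 1) (by rw [PNat.add_coe]; push_cast; rw [hnr, hx]; nlinarith)
  have hcx : 0 < c / x ^ M := by positivity
  have hden : (c / x ^ M) ^ 3 ≤ |a n| ^ 2 * |a (n + 1)| := by
    calc (c / x ^ M) ^ 3 = (c / x ^ M) ^ 2 * (c / x ^ M) := by ring
      _ ≤ |a n| ^ 2 * |a (n + 1)| := by gcongr
  have hxM : (x ^ M) ^ 3 ≤ ((K : ℝ) + 4) ^ (3 * M) * (L : ℝ) ^ (3 * M) * (C₁ * (9 / 8) ^ i) := by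
    rw [← Real.rpow_mul_natCast hx0.le, mul_comm M, hx, Real.mul_rpow (by positivity) (by positivity),
      Real.mul_rpow (by positivity) (by positivity)]
    push_cast
    gcongr
    exact hC₁' i hi
  have hLd : (0 : ℝ) < (L : ℝ) ^ d := by positivity
  have hLd1 : (1 : ℝ) ≤ (L : ℝ) ^ d := one_le_pow₀ hL1
  have hL3M : (1 : ℝ) ≤ (L : ℝ) ^ (3 * M) := Real.one_le_rpow hL1 (by positivity)
  have hpow : (L : ℝ) ^ ((11 * d + 3 * M) / 2) * (L : ℝ) ^ ((11 * d + 3 * M) / 2) =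
      ((L : ℝ) ^ d) ^ 11 * (L : ℝ) ^ (3 * M) := by
    rw [← Real.rpow_add (by positivity), add_halves, Real.rpow_add (by positivity)]
    congr 1
    rw [← pow_mul, ← Real.rpow_natCast]
    push_cast
    ring_nf
  have hrhs : (Real.sqrt D * (L : ℝ) ^ ((11 * d + 3 * M) / 2) * (3 / 4) ^ i) ^ 2 =
      D * (((L : ℝ) ^ d) ^ 11 * (L : ℝ) ^ (3 * M)) * (9 / 16) ^ i := by
    have h916 : (((3 : ℝ) / 4) ^ i) ^ 2 = (9 / 16) ^ i := by
      rw [← pow_mul, mul_comm, pow_mul]; norm_num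
    rw [mul_pow, mul_pow, Real.sq_sqrt hD0.le, sq ((L : ℝ) ^ _), hpow, h916]
  rw [hrhs]
  have hterm1 : 144 * (p ^ 4) ^ 2 * (q : ℝ) ^ 3 * (1 / 2) ^ i / (|a n| ^ 2 * |a (n + 1)|) ≤
      9216 * (3 ^ d) ^ 11 * (((K : ℝ) + 4) ^ (3 * M) * C₁ / c ^ 3) *
        (((L : ℝ) ^ d) ^ 11 * (L : ℝ) ^ (3 * M)) * (9 / 16) ^ i := by
    have h916 : ((9 : ℝ) / 16) ^ i = (9 / 8) ^ i * (1 / 2) ^ i := by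
      rw [← mul_pow]; norm_num
    calc 144 * (p ^ 4) ^ 2 * (q : ℝ) ^ 3 * (1 / 2) ^ i / (|a n| ^ 2 * |a (n + 1)|)
        ≤ 144 * (p ^ 4) ^ 2 * (4 * p) ^ 3 * (1 / 2) ^ i / (c / x ^ M) ^ 3 := by gcongr
      _ = 9216 * p ^ 11 * (1 / 2) ^ i * ((x ^ M) ^ 3 / c ^ 3) := by
          field_simp
          ring
      _ ≤ 9216 * (3 ^ d * (L : ℝ) ^ d) ^ 11 * (1 / 2) ^ i *
          ((((K : ℝ) + 4) ^ (3 * M) * (L : ℝ) ^ (3 * M) * (C₁ * (9 / 8) ^ i)) / c ^ 3) := by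
          gcongr
      _ = _ := by rw [h916]; ring
  have hterm2 : (p ^ 4 / (1 / 2) ^ i) ^ 2 * ((s : ℝ) ^ 2 * (2 * (1 / 2) ^ (n : ℕ))) ≤
      32 * (3 ^ d) ^ 11 * (((L : ℝ) ^ d) ^ 11 * (L : ℝ) ^ (3 * M)) * (9 / 16) ^ i := by
    have hhalf : ((1 : ℝ) / 2) ^ (n : ℕ) ≤ (1 / 2) ^ (3 * i) :=
      pow_le_pow_of_le_one (by norm_num) (by norm_num) (by omega)
    have h3i : ((1 : ℝ) / 2) ^ (3 * i) = ((1 / 2) ^ i) ^ 2 * (1 / 2) ^ i := by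
      rw [← pow_succ, ← pow_mul]; ring_nf
    calc (p ^ 4 / (1 / 2) ^ i) ^ 2 * ((s : ℝ) ^ 2 * (2 * (1 / 2) ^ (n : ℕ)))
        ≤ (p ^ 4 / (1 / 2) ^ i) ^ 2 *
          ((4 * p) ^ 2 * (2 * (((1 / 2) ^ i) ^ 2 * (1 / 2) ^ i))) := by
          rw [← h3i]; gcongr
      _ = 32 * (p ^ 10 * 1) * (1 / 2) ^ i * 1 := by
          field_simp
          ring
      _ ≤ 32 * (p ^ 10 * p) * (9 / 16) ^ i * (L : ℝ) ^ (3 * M) := by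
          have h12 : ((1 : ℝ) / 2) ^ i ≤ (9 / 16) ^ i :=
            pow_le_pow_left₀ (by norm_num) (by norm_num) i
          gcongr
      _ = 32 * p ^ 11 * (9 / 16) ^ i * (L : ℝ) ^ (3 * M) := by ring
      _ ≤ 32 * (3 ^ d * (L : ℝ) ^ d) ^ 11 * (9 / 16) ^ i * (L : ℝ) ^ (3 * M) := by gcongr
      _ = _ := by ring
  calc _ ≤ _ := add_le_add hterm1 hterm2
    _ = _ := by rw [hD]; ring

end AllScales

/-! ### The Wegner estimate -/

section Wegner

variable {d ν : ℕ}

theorem isShiftCount_diffCount (U : Lattice d × Lattice d → ℝ) {L : ℕ}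
    {u' u'' : Lattice d × Lattice d} {Q : Finset (Lattice d)} {m' m'' : ℝ} (hm : 1 ≤ |m' - m''|)
    (hQ : Q ⊆ shadow (L : ℝ) u' ∪ shadow (L : ℝ) u'')
    (h' : ∀ x ∈ cube₂ (L : ℝ) u', occupation Q x = m')
    (h'' : ∀ x ∈ cube₂ (L : ℝ) u'', occupation Q x = m'') :
    IsShiftCount (shadow (L : ℝ) u' ∪ shadow (L : ℝ) u'') Q (((2 * L + 1) ^ d) ^ 4)
      (diffCount U L u' u'') where
  nonneg h V := diffCount_nonneg U L u' u'' h V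
  le α β V := by
    refine (diffCount_le U L u' u'' α β V).trans (le_of_eq ?_)
    rw [card_cube₂_natCast, card_cube₂_natCast]
    push_cast
    ring
  add := diffCount_add U L u' u''
  measurable h := measurable_diffCount U L u' u'' h
  congr h := diffCount_congr U L u' u'' h
  shift := ⟨m' - m'', hm, diffCount_shift U h' h''⟩
  nonempty := by
    -- an empty set would contain no particle of any configuration
    by_contra hne
    rw [Finset.not_nonempty_iff_eq_empty] at hne
    subst hne
    obtain ⟨x, hx⟩ := cube₂_nonempty (Nat.cast_nonneg L) u'
    obtain ⟨y, hy⟩ := cube₂_nonempty (Nat.cast_nonneg L) u''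
    rw [← h' x hx, ← h'' y hy] at hm
    norm_num [occupation] at hm
  subset := hQ

theorem summable_abs_of_le {a : ℕ+ → ℝ} {c κ : ℝ} (hκ : 1 < κ)
    (ha : ∀ n : ℕ+, |a n| ≤ c / (n : ℝ) ^ κ) : Summable fun n => |a n| := by
  have h1 : Summable fun n : ℕ => c / (n : ℝ) ^ κ := by
    simpa [div_eq_mul_inv] using (Real.summable_nat_rpow_inv.2 hκ).mul_left c
  exact Summable.of_nonneg_of_le (fun n => abs_nonneg _) ha
    (h1.comp_injective (i := fun n : ℕ+ => (n : ℕ)) PNat.coe_injective)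

/-- The lower bound which the Diophantine condition gives for the distances of the points of an orbit
over a set of diameter `6 * L ^ r` is polynomial in `L`, hence larger than the size of the dyadic
cells of a level proportional to `L`. -/
theorem exists_level {C₀ B r : ℝ} (hC₀ : 0 < C₀) :
    ∃ K : ℕ, 1 ≤ K ∧ ∀ L : ℕ, 1 ≤ L → (1 / 2 : ℝ) ^ (K * L) ≤ C₀ / (6 * (L : ℝ) ^ r) ^ B := by
  obtain ⟨C, hC, hC'⟩ := exists_rpow_le_mul_pow (r * B) (by norm_num : (1 : ℝ) < 2)
  obtain ⟨k, hk⟩ := pow_unbounded_of_one_lt (6 ^ B * C / C₀) (by norm_num : (1 : ℝ) < 2)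
  refine ⟨k + 1, Nat.le_add_left _ _, fun L hL => ?_⟩
  have hL0 : (0 : ℝ) < L := by exact_mod_cast hL
  rw [one_div, inv_pow, le_div_iff₀ (by positivity), inv_mul_le_iff₀ (by positivity),
    Real.mul_rpow (by norm_num) (by positivity), ← Real.rpow_mul hL0.le]
  rw [div_lt_iff₀ hC₀] at hk
  calc 6 ^ B * (L : ℝ) ^ (r * B) ≤ 6 ^ B * (C * 2 ^ L) := by gcongr; exact hC' L hL
    _ = 6 ^ B * C * 2 ^ L := by ring
    _ ≤ 2 ^ k * C₀ * 2 ^ L := by gcongr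
    _ ≤ 2 ^ (k * L) * C₀ * 2 ^ L := by
        gcongr
        · norm_num
        · exact Nat.le_mul_of_pos_right k hL
    _ = 2 ^ ((k + 1) * L) * C₀ := by rw [add_mul, one_mul, pow_add]; ring

/-- The bound of the expected scaled count, in terms of `L`, for the level `n = K * L`. -/
theorem exists_expectation_bound (d K : ℕ) {a : ℕ+ → ℝ} {c M : ℝ} (hc : 0 < c) (hM : 0 ≤ M)
    (ha : ∀ n : ℕ+, c / (n : ℝ) ^ M ≤ |a n|) :
    ∃ C : ℝ, 0 < C ∧ ∀ (L q : ℕ) (n : ℕ+), 1 ≤ L → q ≤ 4 * (2 * L + 1) ^ d → (n : ℕ) = K * L →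
      6 * (((2 * L + 1) ^ d) ^ 4 : ℝ) * q / |a n| ≤ C * (L : ℝ) ^ (5 * (d : ℝ) + M) := by
  refine ⟨24 * (3 ^ d) ^ 5 * (((K : ℝ) + 1) ^ M / c), by positivity, fun L q n hL hq hn => ?_⟩
  have hL1 : (1 : ℝ) ≤ L := by exact_mod_cast hL
  set p : ℝ := (2 * (L : ℝ) + 1) ^ d with hp
  have hpL : p ≤ 3 ^ d * (L : ℝ) ^ d := by
    rw [← mul_pow]
    exact pow_le_pow_left₀ (by positivity) (by linarith) d
  have hp0 : 0 < p := by positivity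
  have hq' : (q : ℝ) ≤ 4 * p := by rw [hp]; exact_mod_cast hq
  have hn0 : (0 : ℝ) < n := by exact_mod_cast n.pos
  have hnK : (n : ℝ) ≤ ((K : ℝ) + 1) * L := by
    have : ((n : ℕ) : ℝ) = K * L := by rw [hn]; push_cast; ring
    rw [this]
    gcongr
    linarith
  have hlow : c / (((K : ℝ) + 1) * L) ^ M ≤ |a n| := by
    refine le_trans ?_ (ha n)
    gcongr
  have hpow : (L : ℝ) ^ (5 * (d : ℝ) + M) = ((L : ℝ) ^ d) ^ 5 * (L : ℝ) ^ M := by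
    rw [Real.rpow_add (by positivity)]
    congr 1
    rw [← pow_mul, ← Real.rpow_natCast]
    push_cast
    ring_nf
  have hc0 : 0 < c / (((K : ℝ) + 1) * L) ^ M := by positivity
  calc 6 * p ^ 4 * q / |a n| ≤ 6 * p ^ 4 * (4 * p) / (c / (((K : ℝ) + 1) * L) ^ M) := by gcongr
    _ = 24 * p ^ 5 * ((((K : ℝ) + 1) * L) ^ M / c) := by
        field_simp
        ring
    _ ≤ 24 * (3 ^ d * (L : ℝ) ^ d) ^ 5 * ((((K : ℝ) + 1) * L) ^ M / c) := by gcongr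
    _ = _ := by rw [hpow, Real.mul_rpow (by positivity) (by positivity)]; ring

/-- With large probability, the normalized count is bounded simultaneously for all dyadic scales.
The scales down to `2 ^ (-L)` are controlled by their expectations, and the smaller ones by the
second moments of their increments. -/
theorem exists_forall_scaledCount_le (hν : 1 ≤ ν) {a : ℕ+ → ℝ} {c M : ℝ} (hc : 0 < c)
    (hM : 0 ≤ M) (hlow : ∀ n : ℕ+, c / (n : ℝ) ^ M ≤ |a n|) (ha : Summable fun n => |a n|)
    {T : Lattice d → UnitAddTorus (Fin ν) → UnitAddTorus (Fin ν)}
    (hT : ∀ x, MeasurePreserving (T x) volume volume) {K : ℕ} (hK : 1 ≤ K) :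
    ∃ C : ℝ, 0 < C ∧ ∀ (L : ℕ) (S Q : Finset (Lattice d)) (F : ℝ → ℝ → (Lattice d → ℝ) → ℝ),
      1 ≤ L → IsShiftCount S Q (((2 * L + 1) ^ d) ^ 4) F → S.card ≤ 4 * (2 * L + 1) ^ d →
      (∀ ω, ∀ x ∈ S, ∀ y ∈ S, x ≠ y → (1 / 2 : ℝ) ^ (K * L) ≤ dist (T x ω) (T y ω)) →
      ∀ lam : ℝ, 0 < lam → ∃ G : Set (Param ν), MeasurableSet G ∧
        1 - C * (L : ℝ) ^ (5 * (d : ℝ) + M + 1) / lam ≤ (paramMeasure ν).real G ∧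
        ∀ θ ∈ G, ∀ j : ℕ, scaledCount a T F ((1 / 2) ^ j) θ ≤ lam := by
  obtain ⟨C₁, hC₁, hE⟩ := exists_expectation_bound d K hc hM hlow
  obtain ⟨C₂, hC₂, hI⟩ := exists_increment_bound d K hc hM hlow
  obtain ⟨C₃, hC₃, hG⟩ :=
    exists_rpow_le_mul_pow ((11 * d + 3 * M) / 2) (by norm_num : (1 : ℝ) < 4 / 3)
  have hTm : ∀ x, Measurable (T x) := fun x => (hT x).measurable
  have ha0 : ∀ n, a n ≠ 0 := fun n => by
    have hn : (0 : ℝ) < n := by exact_mod_cast n.pos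
    exact abs_pos.1 (lt_of_lt_of_le (by positivity) (hlow n))
  refine ⟨2 * C₁ + 4 * C₂ * C₃, by positivity, fun L S Q F hL hF hS hsep lam hlam => ?_⟩
  have hL1 : (1 : ℝ) ≤ L := by exact_mod_cast hL
  have hQ : Q.card ≤ 4 * (2 * L + 1) ^ d := (Finset.card_le_card hF.subset).trans hS
  have hh : ∀ j : ℕ, (0 : ℝ) < (1 / 2) ^ j := fun j => by positivity
  have hmeas : ∀ j : ℕ, Measurable (scaledCount a T F ((1 / 2) ^ j)) :=
    fun j => hF.measurable_scaledCount ha hTm (hh j)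
  have hbound : ∀ (j : ℕ) (θ : Param ν), ‖scaledCount a T F ((1 / 2) ^ j) θ‖ ≤
      ((2 * (L : ℝ) + 1) ^ d) ^ 4 / (2 * (1 / 2) ^ j) := by
    intro j θ
    have h := norm_integral_le_of_norm_le_const (μ := (volume : Measure (UnitAddTorus (Fin ν))))
      (f := fun ω => F (-(1 / 2) ^ j) ((1 / 2) ^ j) (potential a T ω θ) / (2 * (1 / 2) ^ j))
      (C := ((2 * (L : ℝ) + 1) ^ d) ^ 4 / (2 * (1 / 2) ^ j)) (ae_of_all _ fun ω => by
        rw [Real.norm_eq_abs, abs_div, abs_of_pos (by positivity : (0 : ℝ) < 2 * (1 / 2) ^ j)]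
        exact div_le_div_of_nonneg_right (hF.abs_le (by linarith [hh j]) _) (by positivity))
    rwa [probReal_univ, mul_one] at h
  have hint : ∀ j : ℕ, Integrable (scaledCount a T F ((1 / 2) ^ j)) (paramMeasure ν) := fun j =>
    Integrable.of_bound (hmeas j).aestronglyMeasurable _ (ae_of_all _ (hbound j))
  -- the scales down to `2 ^ (-L)`
  have hKL : 0 < K * L := Nat.mul_pos hK hL
  have hA : ∀ j ≤ L, ∫ θ, scaledCount a T F ((1 / 2) ^ j) θ ∂paramMeasure ν ≤
      C₁ * (L : ℝ) ^ (5 * (d : ℝ) + M) := fun j _ =>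
    (hF.integral_scaledCount_le ha hTm (n := ⟨K * L, hKL⟩) (ha0 _) (fun ω x hx y hy hxy =>
      cellIndex_ne_of_le_dist le_rfl (hsep ω x hx y hy hxy)) (hh j)).trans
      (hE L Q.card ⟨K * L, hKL⟩ hL hQ rfl)
  -- the increments between smaller scales
  have hinc : ∀ k : ℕ, ∫ θ, |scaledCount a T F ((1 / 2) ^ (L + k + 1)) θ -
      scaledCount a T F ((1 / 2) ^ (L + k)) θ| ∂paramMeasure ν ≤ C₂ * C₃ * (3 / 4) ^ k := by
    intro k
    set i : ℕ := L + k + 1 with hi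
    have hpos : 0 < K * L + 3 * i := by omega
    have h2 : 2 * ((1 : ℝ) / 2) ^ i = (1 / 2) ^ (L + k) := by rw [hi, pow_succ]; ring
    have hsq := hF.integral_sq_scaledCount_sub_le hν ha ha0 hT (n := ⟨K * L + 3 * i, hpos⟩)
      (fun ω x hx y hy hxy => (pow_le_pow_of_le_one (by norm_num) (by norm_num)
        (Nat.le_add_right _ _)).trans (hsep ω x hx y hy hxy)) (hh i)
    rw [h2] at hsq
    have hsq' := hsq.trans
      (hI L i Q.card S.card ⟨K * L + 3 * i, hpos⟩ hL (by omega) hQ hS rfl)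
    have hLpos : (0 : ℝ) < (L : ℝ) ^ ((11 * d + 3 * M) / 2) := by positivity
    have hsqint : Integrable (fun θ => (scaledCount a T F ((1 / 2) ^ (L + k)) θ -
        scaledCount a T F ((1 / 2) ^ i) θ) ^ 2) (paramMeasure ν) := by
      refine Integrable.of_bound (((hmeas _).sub (hmeas _)).pow_const 2).aestronglyMeasurable
        ((((2 * (L : ℝ) + 1) ^ d) ^ 4 / (2 * (1 / 2) ^ (L + k)) +
          ((2 * (L : ℝ) + 1) ^ d) ^ 4 / (2 * (1 / 2) ^ i)) ^ 2) (ae_of_all _ fun θ => ?_)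
      rw [norm_pow]
      exact pow_le_pow_left₀ (norm_nonneg _)
        ((norm_sub_le _ _).trans (add_le_add (hbound _ θ) (hbound _ θ))) 2
    have habs := integral_abs_le_of_integral_sq_le hsqint (by positivity) hsq'
    simp_rw [abs_sub_comm (scaledCount a T F ((1 / 2) ^ i) _)]
    refine habs.trans ?_
    calc C₂ * (L : ℝ) ^ ((11 * d + 3 * M) / 2) * (3 / 4) ^ i
        ≤ C₂ * (C₃ * (4 / 3) ^ L) * (3 / 4) ^ i := by gcongr; exact hG L hL
      _ = C₂ * C₃ * (3 / 4) ^ k * ((4 / 3 * (3 / 4)) ^ L * (3 / 4)) := by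
          rw [hi, pow_succ, pow_add, mul_pow]; ring
      _ ≤ C₂ * C₃ * (3 / 4) ^ k * 1 := by gcongr; norm_num
      _ = _ := mul_one _
  have hgeom : Summable fun k : ℕ => C₂ * C₃ * (3 / 4 : ℝ) ^ k :=
    (summable_geometric_of_lt_one (by norm_num) (by norm_num)).mul_left _
  obtain ⟨G, hGm, hGμ, hGb⟩ := exists_uniform_bound hmeas hint
    (fun j θ => hF.scaledCount_nonneg (hh j) θ) hlam hA hgeom hinc
  refine ⟨G, hGm, le_trans ?_ hGμ, hGb⟩
  have hsum : ∑' k : ℕ, C₂ * C₃ * (3 / 4 : ℝ) ^ k = 4 * C₂ * C₃ := by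
    rw [tsum_mul_left, tsum_geometric_of_lt_one (by norm_num) (by norm_num)]
    ring
  rw [hsum]
  gcongr
  have hpow : (L : ℝ) ^ (5 * (d : ℝ) + M + 1) = (L : ℝ) ^ (5 * (d : ℝ) + M) * L := by
    rw [Real.rpow_add (by positivity), Real.rpow_one]
  have hone : 1 ≤ (L : ℝ) ^ (5 * (d : ℝ) + M + 1) := Real.one_le_rpow hL1 (by positivity)
  calc ((L : ℝ) + 1) * (C₁ * (L : ℝ) ^ (5 * (d : ℝ) + M)) + 4 * C₂ * C₃
      ≤ (L + L) * (C₁ * (L : ℝ) ^ (5 * (d : ℝ) + M)) +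
        4 * C₂ * C₃ * (L : ℝ) ^ (5 * (d : ℝ) + M + 1) := by
        refine add_le_add (by gcongr) (le_mul_of_one_le_right (by positivity) hone)
    _ = _ := by rw [hpow]; ring

/-- Markov's inequality for the number of pairs of eigenvalues at distance at most `h`. -/
theorem volume_setDist_le {a : ℕ+ → ℝ} (ha : Summable fun n => |a n|)
    {T : Lattice d → UnitAddTorus (Fin ν) → UnitAddTorus (Fin ν)} (hT : ∀ x, Measurable (T x))
    (U : Lattice d × Lattice d → ℝ) {R : ℝ} (hR : 0 ≤ R) (u' u'' : Lattice d × Lattice d)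
    (θ : Param ν) {h : ℝ} (hh : 0 < h) :
    volume.real {ω : UnitAddTorus (Fin ν) | setDist (spec U (potential a T ω θ) R u')
      (spec U (potential a T ω θ) R u'') ≤ h} ≤
      4 * h * scaledCount a T (diffCount U R u' u'') h θ := by
  have hm : Measurable fun ω => diffCount U R u' u'' (-h) h (potential a T ω θ) :=
    (measurable_diffCount U R u' u'' (by linarith)).comp (measurable_potential_left ha hT θ)
  have h0 : ∀ ω, 0 ≤ diffCount U R u' u'' (-h) h (potential a T ω θ) :=
    fun ω => diffCount_nonneg U R u' u'' (by linarith) _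
  have hint : Integrable fun ω => diffCount U R u' u'' (-h) h (potential a T ω θ) := by
    refine Integrable.of_bound hm.aestronglyMeasurable
      ((cube₂ R u').card * (cube₂ R u'').card) (ae_of_all _ fun ω => ?_)
    rw [Real.norm_of_nonneg (h0 ω)]
    exact diffCount_le U R u' u'' _ _ _
  have hmarkov := mul_meas_ge_le_integral_of_nonneg (ae_of_all _ h0) hint (1 / 2)
  have hsub : volume.real {ω : UnitAddTorus (Fin ν) | setDist (spec U (potential a T ω θ) R u')
      (spec U (potential a T ω θ) R u'') ≤ h} ≤ volume.real {ω : UnitAddTorus (Fin ν) |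
        1 / 2 ≤ diffCount U R u' u'' (-h) h (potential a T ω θ)} :=
    measureReal_mono fun ω hω => half_le_diffCount U u' u'' hR hh _ hω
  have hsc : 4 * h * scaledCount a T (diffCount U R u' u'') h θ =
      2 * ∫ ω, diffCount U R u' u'' (-h) h (potential a T ω θ) := by
    rw [scaledCount, integral_div]
    field_simp
    ring
  rw [hsc]
  linarith

end Wegner

end TwoParticle

theorem theorem2
    -- dimensions of the lattice and of the torus
    (d ν : ℕ) (hd : 1 ≤ d) (hν : 1 ≤ ν)
    -- amplitudes
    (a : ℕ+ → ℝ) (c' c'' κ M : ℝ) (hc' : 0 < c') (hc'' : 0 < c'') (hκ : 1 < κ) (hκM : κ ≤ M)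
    (ha_lower : ∀ n : ℕ+, c'' / (n : ℝ) ^ M ≤ |a n|)
    (ha_upper : ∀ n : ℕ+, |a n| ≤ c' / (n : ℝ) ^ κ)
    -- the action of `ℤ^d` on the torus, and its Diophantine condition
    (T : TwoParticle.Lattice d → UnitAddTorus (Fin ν) → UnitAddTorus (Fin ν))
    (hT_zero : ∀ ω, T 0 ω = ω)
    (hT_add : ∀ x y ω, T (x + y) ω = T x (T y ω))
    (hT_meas : ∀ x, MeasurePreserving (T x) volume volume)
    (C₀ B : ℝ) (hC₀ : 0 < C₀) (hB : 0 < B)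
    (hT_dioph : ∀ x : TwoParticle.Lattice d, x ≠ 0 → ∀ ω, C₀ / ‖x‖ ^ B ≤ dist ω (T x ω))
    -- the interaction
    (U : TwoParticle.Lattice d × TwoParticle.Lattice d → ℝ)
    (b r : ℝ) (hb : 0 < b) (hr : 1 < r) :
    ∃ Const : ℝ, 0 < Const ∧
      ∀ (L : ℕ), 1 ≤ L → ∀ (u' u'' : TwoParticle.Lattice d × TwoParticle.Lattice d),
        (∃ v : TwoParticle.Lattice d,
          TwoParticle.shadow (L : ℝ) u' ⊆ TwoParticle.cube ((L : ℝ) ^ r) v) →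
        ‖u' - u''‖ ≤ (L : ℝ) ^ r →
        8 * (L : ℝ) < min ‖u'' - u'‖ ‖u'' - u'.swap‖ →
        ∃ ΘL : Set (TwoParticle.Param ν), MeasurableSet ΘL ∧
          1 - (L : ℝ) ^ (-b) ≤ (TwoParticle.paramMeasure ν).real ΘL ∧
          ∀ θ ∈ ΘL, ∀ ε : ℝ, 0 < ε →
            volume.real {ω : UnitAddTorus (Fin ν) |
              TwoParticle.setDist
                (TwoParticle.spec U (TwoParticle.potential a T ω θ) (L : ℝ) u')
                (TwoParticle.spec U (TwoParticle.potential a T ω θ) (L : ℝ) u'') ≤ ε}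
              ≤ Const * (L : ℝ) ^ (M + b + r + 5 * (d : ℝ)) * ε := by
  open TwoParticle in
  have hM : 0 ≤ M := by linarith
  have hsum := summable_abs_of_le hκ ha_upper
  have hTm : ∀ x, Measurable (T x) := fun x => (hT_meas x).measurable
  obtain ⟨K, hK, hlevel⟩ := exists_level (B := B) (r := r) hC₀
  obtain ⟨C, hC, hG⟩ := exists_forall_scaledCount_le hν hc'' hM ha_lower hsum hT_meas hK
  refine ⟨8 * C + 1, by positivity, fun L hL u' u'' hv hu hfar => ?_⟩
  obtain ⟨v, hv⟩ := hv
  obtain ⟨Q, m', m'', hm, hQ, h', h''⟩ := exists_separating_set L u' u'' hfar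
  have hF := isShiftCount_diffCount U hm hQ h' h''
  have hL1 : (1 : ℝ) ≤ L := by exact_mod_cast hL
  have hL0 : (0 : ℝ) < L := by linarith
  have hS : (shadow (L : ℝ) u' ∪ shadow (L : ℝ) u'').card ≤ 4 * (2 * L + 1) ^ d := by
    have h1 := card_shadow_natCast_le L u'
    have h2 := card_shadow_natCast_le L u''
    have h3 := Finset.card_union_le (shadow (L : ℝ) u') (shadow (L : ℝ) u'')
    linarith
  have hsep : ∀ ω, ∀ x ∈ shadow (L : ℝ) u' ∪ shadow (L : ℝ) u'',
      ∀ y ∈ shadow (L : ℝ) u' ∪ shadow (L : ℝ) u'', x ≠ y →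
        (1 / 2 : ℝ) ^ (K * L) ≤ dist (T x ω) (T y ω) := by
    intro ω x hx y hy hxy
    have hyx : y - x ≠ 0 := sub_ne_zero.2 hxy.symm
    have h1 := hT_dioph (y - x) hyx (T x ω)
    rw [← hT_add, sub_add_cancel] at h1
    have h2 : ‖y - x‖ ≤ 6 * (L : ℝ) ^ r := norm_sub_le_of_mem_shadow hL hr.le hv hu hy hx
    have h3 : 0 < ‖y - x‖ := norm_pos_iff.2 hyx
    refine (hlevel L hL).trans (le_trans ?_ h1)
    gcongr
  set E : ℝ := M + b + r + 5 * (d : ℝ) with hE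
  have hLE : 1 ≤ (L : ℝ) ^ E := Real.one_le_rpow hL1 (by positivity)
  have hlam : 0 < C * (L : ℝ) ^ E := by positivity
  obtain ⟨G, hGm, hGμ, hGb⟩ := hG L _ Q _ hL hF hS hsep _ hlam
  refine ⟨G, hGm, le_trans ?_ hGμ, fun θ hθ ε hε => ?_⟩
  · rw [mul_div_mul_left _ _ hC.ne', ← Real.rpow_sub hL0]
    have : (L : ℝ) ^ (5 * (d : ℝ) + M + 1 - E) ≤ (L : ℝ) ^ (-b) :=
      Real.rpow_le_rpow_of_exponent_le hL1 (by rw [hE]; linarith)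
    linarith
  · rcases le_or_gt 1 ε with h1 | h1
    · calc _ ≤ (1 : ℝ) := measureReal_le_one
        _ ≤ (8 * C + 1) * (L : ℝ) ^ E * ε :=
            one_le_mul_of_one_le_of_one_le
              (one_le_mul_of_one_le_of_one_le (by linarith) hLE) h1
    · -- the dyadic scale `h` with `h / 2 < ε ≤ h`
      obtain ⟨j, hj1, hj2⟩ := exists_nat_pow_near_of_lt_one hε h1.le
        (by norm_num : (0 : ℝ) < 1 / 2) (by norm_num)
      have hj : (0 : ℝ) < (1 / 2) ^ j := by positivity
      have hεj : ((1 : ℝ) / 2) ^ j ≤ 2 * ε := by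
        rw [pow_succ] at hj1
        linarith
      calc _ ≤ volume.real {ω : UnitAddTorus (Fin ν) | setDist
              (spec U (potential a T ω θ) (L : ℝ) u') (spec U (potential a T ω θ) (L : ℝ) u'') ≤
                (1 / 2) ^ j} := measureReal_mono fun ω hω => le_trans hω hj2
        _ ≤ 4 * (1 / 2) ^ j * scaledCount a T (diffCount U L u' u'') ((1 / 2) ^ j) θ :=
            volume_setDist_le hsum hTm U hL0.le u' u'' θ hj
        _ ≤ 4 * (2 * ε) * (C * (L : ℝ) ^ E) := by
            gcongr
            · exact hF.scaledCount_nonneg hj θ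
            · exact hGb θ hθ j
        _ = 8 * C * (L : ℝ) ^ E * ε := by ring
        _ ≤ (8 * C + 1) * (L : ℝ) ^ E * ε := by gcongr; linarith
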